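/- **Proposition (explicit expression for the resolvent of $\mathcal A$).** Let $a,b,\alpha>0$, $\xi\in(0,1)$, $\mu\in\mathbb C$. Let $\mathcal H=[H^2(0,1)\cap H^1_0(0,1)]\times L^2(0,1)$ (complex-valued functions) and let $\mathcal A:D(\mathcal A)\to\mathcal H$ be $$\mathcal A(u,v)=\bigl(v,\,-a\,u_{xxxx}-b\,v-\alpha\,v(\xi)\,\delta_\xi\bigr)$$ (derivatives in the sense of distributions on $(0,1)$), where $D(\mathcal A)$ is the set of $(u,v)\in\mathcal H$ with $u\in H^4(0,\xi)\cap H^4(\xi,1)\cap H^2(0,1)$, $v\in H^2(0,1)$, $u=v=0$ and $u_{xx}=0$ at $x=0$ and $x=1$, $u_{xx}(\xi^-)=u_{xx}(\xi^+)$ and $u_{xxx}(\xi^+)-u_{xxx}(\xi^-)=-\frac{\alpha}{a}v(\xi)$. Let $F=(u_1,v_1)\in\mathcal H$, let $\lambda\in\mathbb C$ satisfy $\lambda^4=-(b\mu+\mu^2)/a$, and let $H(x)=1$ for $x\ge 0$, $H(x)=0$ for $x<0$. For $x\in[0,1]$ write $(\psi\star f)(x)=\int_0^x\psi(x-s)f(s)\,ds$;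 when derivatives are taken at $x=1$, $f$ is extended by $0$ outside $[0,1]$. Put $$f_1^0=(\mu+b)u_1+v_1,\qquad u_0(\lambda,x)=\frac{\sinh(\lambda x)-\sin(\lambda x)}{2a\lambda^3}\,H(x),$$ $$Det^\alpha(\lambda)=4\lambda^2\Bigl\{\bigl[-2\lambda^3\sinh\lambda-\tfrac{\alpha\mu}{a}\sinh(\lambda\xi)\sinh(\lambda(\xi-1))\bigr]\sin\lambda+\tfrac{\alpha\mu}{a}\sin(\lambda\xi)\sinh\lambda\,\sin(\lambda(\xi-1))\Bigr\},$$ $$Det^0(\lambda)=-8\lambda^5\sinh\lambda\,\sin\lambda,$$ $$A=\lambda^2(u_0\star f_1^0)(1)+\lambda^2\alpha\,u_1(\xi)\,u_0(\lambda,1-\xi),\quad B=(u_0\star f_1^0)_{xx}(1)+\alpha\,u_1(\xi)\,u_{0,xx}(\lambda,1-\xi),\quad C=\lambda^2(u_0\star f_1^0)(\xi),$$ $$\Delta=\tfrac{4\lambda^2\mu}{a}\bigl(\sin(\lambda\xi)\sin(\lambda(\xi-1))\sinh\lambda-\sinh(\lambda\xi)\sinh(\lambda(\xi-1))\sin\lambda\bigr),$$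 $$\Delta_3=\tfrac{4\lambda\mu}{a}\Bigl\{\sin(\lambda(\xi-1))\bigl(\tfrac{A+B}{2}[\sinh(\lambda\xi)-\sin(\lambda\xi)]-C\sinh\lambda\bigr)+\sinh(\lambda(\xi-1))\bigl(\tfrac{A-B}{2}[\sinh(\lambda\xi)-\sin(\lambda\xi)]+C\sin\lambda\bigr)\Bigr\},$$ $$\Delta_1=\tfrac{4\lambda^3\mu}{a}\Bigl\{\sin(\lambda(\xi-1))\bigl(-\tfrac{A+B}{2}[\sinh(\lambda\xi)+\sin(\lambda\xi)]+C\sinh\lambda\bigr)+\sinh(\lambda(\xi-1))\bigl(-\tfrac{A-B}{2}[\sinh(\lambda\xi)+\sin(\lambda\xi)]+C\sin\lambda\bigr)\Bigr\},$$ $$\Delta_0=-4\lambda^3\bigl\{2C\sin\lambda\sinh\lambda-(A+B)\sin\lambda\sinh(\lambda\xi)-(A-B)\sin(\lambda\xi)\sinh\lambda\bigr\},$$ $$R(x)=(u_0\star f_1^0)(x)+\frac{a}{Det^0(\lambda)}\Bigl[4\lambda^4\{(A-B)\sinh\lambda+(A+B)\sin\lambda\}\,u_{0,xx}(\lambda,x)+4\lambda^6\{(A+B)\sin\lambda-(A-B)\sinh\lambda\}\,u_0(\lambda,x)\Bigr].$$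 ($R$ depends on $\alpha$ only through $A$ and $B$; formally, for $\alpha=0$ it is the resolvent of $\mathcal A$ with $\alpha=0$.) If $Det^\alpha(\lambda)\ne 0$ (in particular $\lambda\neq0$), then $(\mu I-\mathcal A)U=F$ has exactly one solution $U=(u,v)\in D(\mathcal A)$, and for all $x\in[0,1]$ $$u(x)=\frac{1}{Det^\alpha(\lambda)}\Bigl(Det^0(\lambda)R(x)+\alpha\bigl[\Delta\,(u_0\star f_1^0)(x)+a\Delta_1u_0(\lambda,x)+a\Delta_3u_{0,xx}(\lambda,x)+\bigl(u_1(\xi)\,Det^\alpha(\lambda)-\mu\Delta_0\bigr)u_0(\lambda,x-\xi)\bigr]\Bigr),$$ $$v(x)=\mu u(x)-u_1(x),$$ where, if $Det^0(\lambda)=0$, the product $Det^0(\lambda)R(x)$ is read with the denominator $Det^0(\lambda)$ cleared. -/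

import Mathlib

open MeasureTheory
open scoped ContDiff

noncomputable section

namespace Beam

/-- Complex-valued test functions on the open interval `(c, d)`. -/
structure IsTestFunction (c d : ℝ) (φ : ℝ → ℂ) : Prop where
  smooth : ContDiff ℝ ∞ φ
  compact : HasCompactSupport φ
  support : tsupport φ ⊆ Set.Ioo c d

/-- `g` is the weak (distributional) derivative of `f` on `(c, d)`. -/
def HasWeakDeriv (c d : ℝ) (f g : ℝ → ℂ) : Prop :=
  ∀ φ : ℝ → ℂ, IsTestFunction c d φ →
    ∫ x in Set.Ioo c d, f x * deriv φ x = -∫ x in Set.Ioo c d, g x * φ x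

/-- `f` belongs to `L²(c, d)`. -/
def MemL2 (c d : ℝ) (f : ℝ → ℂ) : Prop :=
  MemLp f 2 (volume.restrict (Set.Ioo c d))

/-- `D 0 = u, D 1, …, D m` are the weak derivatives of `u ∈ H^m(c, d)`, where `D j` for `j < m`
is the continuous representative on `[c, d]` (which exists for every element of `H^m(c, d)`), so
that `D j x` for `x ∈ [c, d]` and `j < m` is the value (or one-sided trace) at `x` of the `j`-th
derivative of `u`. The values of the functions outside `[c, d]` are irrelevant. -/
structure IsSobolevDerivs (m : ℕ) (c d : ℝ) (u : ℝ → ℂ) (D : ℕ → ℝ → ℂ) : Prop where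
  zero : ∀ x ∈ Set.Icc c d, D 0 x = u x
  cont : ∀ j, j < m → ContinuousOn (D j) (Set.Icc c d)
  memL2 : ∀ j, j ≤ m → MemL2 c d (D j)
  deriv : ∀ j, j < m → HasWeakDeriv c d (D j) (D (j + 1))

/-- `u` is (the continuous representative of) an element of `H^m(c, d)`, `m ≥ 1`. -/
def MemSobolev (m : ℕ) (c d : ℝ) (u : ℝ → ℂ) : Prop :=
  ∃ D : ℕ → ℝ → ℂ, IsSobolevDerivs m c d u D

/-- `(u, v) ∈ 𝓗 = [H²(0,1) ∩ H¹₀(0,1)] × L²(0,1)`. -/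
structure InEnergySpace (u v : ℝ → ℂ) : Prop where
  sobolev : MemSobolev 2 0 1 u
  left : u 0 = 0
  right : u 1 = 0
  memL2 : MemL2 0 1 v

/-- `(u, v) ∈ D(𝒜)`. The functions `l j` and `r j` are the `j`-th derivatives of `u` on `(0, ξ)`
and on `(ξ, 1)`. -/
structure InDomain (a α ξ : ℝ) (u v : ℝ → ℂ) : Prop where
  energy : InEnergySpace u v
  sobolev_snd : MemSobolev 2 0 1 v
  left_snd : v 0 = 0
  right_snd : v 1 = 0
  pieces : ∃ l r : ℕ → ℝ → ℂ,
    IsSobolevDerivs 4 0 ξ u l ∧ IsSobolevDerivs 4 ξ 1 u r ∧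
    l 2 0 = 0 ∧ r 2 1 = 0 ∧ l 2 ξ = r 2 ξ ∧
    r 3 ξ - l 3 ξ = -((α : ℂ) / a) * v ξ

/-- `𝒜(u, v) = (w, z)`, that is, `w = v` and `z ∈ L²(0,1)` equals
`-a u⁗ - b v - α v(ξ) δ_ξ` in the sense of distributions on `(0, 1)`. -/
structure OperatorMapsTo (a b α ξ : ℝ) (u v w z : ℝ → ℂ) : Prop where
  domain : InDomain a α ξ u v
  fst : ∀ x ∈ Set.Icc (0 : ℝ) 1, w x = v x
  memL2 : MemL2 0 1 z
  snd : ∀ φ : ℝ → ℂ, IsTestFunction 0 1 φ →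
    ∫ x in Set.Ioo (0 : ℝ) 1, z x * φ x =
      -(a : ℂ) * (∫ x in Set.Ioo (0 : ℝ) 1, u x * iteratedDeriv 4 φ x)
        - (b : ℂ) * (∫ x in Set.Ioo (0 : ℝ) 1, v x * φ x)
        - (α : ℂ) * v ξ * φ ξ

/-- `(u, v) ∈ D(𝒜)` and `(μ I - 𝒜)(u, v) = (u₁, v₁)` in `𝓗`. -/
def SolvesResolvent (a b α ξ : ℝ) (μ : ℂ) (u₁ v₁ u v : ℝ → ℂ) : Prop :=
  ∃ w z : ℝ → ℂ, OperatorMapsTo a b α ξ u v w z ∧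
    (∀ x ∈ Set.Icc (0 : ℝ) 1, μ * u x - w x = u₁ x) ∧
    (∀ᵐ x ∂(volume.restrict (Set.Ioo (0 : ℝ) 1)), μ * v x - z x = v₁ x)

/-- The convolution of `ψ`, extended by zero to `(-∞, 0)`, and of `f`, extended by zero outside
`[0, 1]`. On `[0, 1]` it is `∫₀ˣ ψ(x - s) f(s) ds`. -/
def conv (ψ f : ℝ → ℂ) (x : ℝ) : ℂ :=
  ∫ s in (0 : ℝ)..x, ψ (x - s) * (Set.Icc (0 : ℝ) 1).indicator f s

/-- `f₁⁰ = (μ + b) u₁ + v₁`. -/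
def f10 (b : ℝ) (μ : ℂ) (u₁ v₁ : ℝ → ℂ) (x : ℝ) : ℂ :=
  (μ + b) * u₁ x + v₁ x

/-- The Heaviside step function at `0`. -/
def heaviside (x : ℝ) : ℂ := if 0 ≤ x then 1 else 0

/-- `u₀(λ, x) = (sinh (λ x) - sin (λ x)) H(x, 0) / (2 a λ³)`, whose Laplace transform is
`1 / (a p⁴ - a λ⁴)`. -/
def u0 (a : ℝ) (lam : ℂ) (x : ℝ) : ℂ :=
  1 / (2 * a * lam ^ 3) * (Complex.sinh (lam * x) - Complex.sin (lam * x)) * heaviside x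

/-- The second derivative `u_{0,xx}(λ, x)`. -/
def u0xx (a : ℝ) (lam : ℂ) (x : ℝ) : ℂ :=
  iteratedDeriv 2 (u0 a lam) x

/-- `Det^α(λ)`. -/
def detAlpha (a α ξ : ℝ) (μ lam : ℂ) : ℂ :=
  4 * lam ^ 2 *
    ((-2 * lam ^ 3 * Complex.sinh lam
        - α * μ / a * Complex.sinh (lam * ξ) * Complex.sinh (lam * (ξ - 1))) * Complex.sin lam
      + α * μ / a * Complex.sin (lam * ξ) * Complex.sinh lam * Complex.sin (lam * (ξ - 1)))

/-- `Det⁰(λ)`. -/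
def detZero (lam : ℂ) : ℂ :=
  -8 * lam ^ 5 * Complex.sinh lam * Complex.sin lam

/-- `A(λ, α)`. -/
def coeffA (a b α ξ : ℝ) (μ lam : ℂ) (u₁ v₁ : ℝ → ℂ) : ℂ :=
  lam ^ 2 * conv (u0 a lam) (f10 b μ u₁ v₁) 1 + lam ^ 2 * α * u₁ ξ * u0 a lam (1 - ξ)

/-- `B(λ, α)`. -/
def coeffB (a b α ξ : ℝ) (μ lam : ℂ) (u₁ v₁ : ℝ → ℂ) : ℂ :=
  iteratedDeriv 2 (conv (u0 a lam) (f10 b μ u₁ v₁)) 1 + α * u₁ ξ * u0xx a lam (1 - ξ)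

/-- `C(λ, ξ)`. -/
def coeffC (a b ξ : ℝ) (μ lam : ℂ) (u₁ v₁ : ℝ → ℂ) : ℂ :=
  lam ^ 2 * conv (u0 a lam) (f10 b μ u₁ v₁) ξ

/-- The bracket in the definition of `R(μ, 𝒜₀)F`. -/
def bracketZero (a : ℝ) (lam A B : ℂ) (x : ℝ) : ℂ :=
  4 * lam ^ 4 * ((A - B) * Complex.sinh lam + (A + B) * Complex.sin lam) * u0xx a lam x
    + 4 * lam ^ 6 * ((A + B) * Complex.sin lam - (A - B) * Complex.sinh lam) * u0 a lam x

/-- `R(μ, 𝒜₀)F`; meaningful when `Det⁰(λ) ≠ 0`. -/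
def resolventZero (a b α ξ : ℝ) (μ lam : ℂ) (u₁ v₁ : ℝ → ℂ) (x : ℝ) : ℂ :=
  conv (u0 a lam) (f10 b μ u₁ v₁) x
    + a / detZero lam *
      bracketZero a lam (coeffA a b α ξ μ lam u₁ v₁) (coeffB a b α ξ μ lam u₁ v₁) x

/-- `Det⁰(λ) · R(μ, 𝒜₀)F` with the denominator `Det⁰(λ)` cleared, so that it also makes sense
when `Det⁰(λ) = 0`. -/
def detZeroResolventZero (a b α ξ : ℝ) (μ lam : ℂ) (u₁ v₁ : ℝ → ℂ) (x : ℝ) : ℂ :=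
  detZero lam * conv (u0 a lam) (f10 b μ u₁ v₁) x
    + a * bracketZero a lam (coeffA a b α ξ μ lam u₁ v₁) (coeffB a b α ξ μ lam u₁ v₁) x

/-- `Δ(λ, ξ)`. -/
def Delta (a ξ : ℝ) (μ lam : ℂ) : ℂ :=
  4 * lam ^ 2 * μ / a *
    (Complex.sin (lam * ξ) * Complex.sin (lam * (ξ - 1)) * Complex.sinh lam
      - Complex.sinh (lam * ξ) * Complex.sinh (lam * (ξ - 1)) * Complex.sin lam)

/-- `Δ₃(λ, ξ)`. -/
def Delta3 (a ξ : ℝ) (μ lam A B C : ℂ) : ℂ :=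
  4 * lam * μ / a *
    (Complex.sin (lam * (ξ - 1)) *
        ((A + B) / 2 * (Complex.sinh (lam * ξ) - Complex.sin (lam * ξ)) - C * Complex.sinh lam)
      + Complex.sinh (lam * (ξ - 1)) *
        ((A - B) / 2 * (Complex.sinh (lam * ξ) - Complex.sin (lam * ξ)) + C * Complex.sin lam))

/-- `Δ₁(λ, ξ)`. -/
def Delta1 (a ξ : ℝ) (μ lam A B C : ℂ) : ℂ :=
  4 * lam ^ 3 * μ / a *
    (Complex.sin (lam * (ξ - 1)) *
        (-((A + B) / 2) * (Complex.sinh (lam * ξ) + Complex.sin (lam * ξ)) + C * Complex.sinh lam)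
      + Complex.sinh (lam * (ξ - 1)) *
        (-((A - B) / 2) * (Complex.sinh (lam * ξ) + Complex.sin (lam * ξ)) + C * Complex.sin lam))

/-- `Δ₀(λ, ξ)`. -/
def Delta0 (ξ : ℝ) (lam A B C : ℂ) : ℂ :=
  -4 * lam ^ 3 *
    (2 * C * Complex.sin lam * Complex.sinh lam
      - (A + B) * Complex.sin lam * Complex.sinh (lam * ξ)
      - (A - B) * Complex.sin (lam * ξ) * Complex.sinh lam)

/-- The `α`-correction in the resolvent formula:
`Δ (u₀ ⋆ f₁⁰)(x) + a Δ₁ u₀(λ,x) + a Δ₃ u_{0,xx}(λ,x) + (u₁(ξ) Det^α(λ) - μ Δ₀) u₀(λ, x - ξ)`. -/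
def correction (a b α ξ : ℝ) (μ lam : ℂ) (u₁ v₁ : ℝ → ℂ) (x : ℝ) : ℂ :=
  let A := coeffA a b α ξ μ lam u₁ v₁
  let B := coeffB a b α ξ μ lam u₁ v₁
  let C := coeffC a b ξ μ lam u₁ v₁
  Delta a ξ μ lam * conv (u0 a lam) (f10 b μ u₁ v₁) x
    + a * Delta1 a ξ μ lam A B C * u0 a lam x
    + a * Delta3 a ξ μ lam A B C * u0xx a lam x
    + (u₁ ξ * detAlpha a α ξ μ lam - μ * Delta0 ξ lam A B C) * u0 a lam (x - ξ)

end Beam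

end

/-!
Solving for `v = μ u - u₁`, the resolvent equation becomes `u⁗ = λ⁴ u + a⁻¹ f₁⁰` on `(0, ξ)` and
on `(ξ, 1)`, where `u''` is continuous and `u'''` jumps by `(α / a) (u₁(ξ) - μ u(ξ))` at `ξ`: test
the equation with functions supported in one of the two intervals, and recall that by the lemma of
du Bois-Reymond a function with a weak derivative is, up to a constant, the integral of it.

Shooting from `0`, every solution with `u = u'' = 0` at `0` is
`u₀ ⋆ f₁⁰ + p u₀ + q u₀'' + α (u₁(ξ) - μ u(ξ)) u₀(· - ξ)`, uniquely by Gronwall's inequality. The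
two conditions at `1` and the value at `ξ` form a linear system of size three for `p`, `q` and
`u(ξ)`; its determinant is `Det^α(λ)` up to a nonzero factor, and Cramer's rule produces `Δ₀`, `Δ₁`
and `Δ₃`.
-/

noncomputable section

namespace Beam

open Set Filter Topology

section Triangle

variable {E : Type*} [NormedAddCommGroup E] {F : ℝ → ℝ → E} {c d : ℝ}

theorem integrable_triangle
    (hF : Integrable F.uncurry ((volume.restrict (Ioc c d)).prod (volume.restrict (Ioc c d)))) :
    Integrable (Function.uncurry fun t => (Iic t).indicator (F t))
      ((volume.restrict (Ioc c d)).prod (volume.restrict (Ioc c d))) :=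
  (hF.indicator (measurableSet_le measurable_snd measurable_fst)).congr
    (ae_of_all _ fun _ => by simp [indicator, Function.uncurry])

variable [NormedSpace ℝ E]

theorem setIntegral_indicator_Iic_eq_intervalIntegral {t : ℝ} (ht : t ∈ Ioc c d) :
    ∫ s in Ioc c d, (Iic t).indicator (F t) s = ∫ s in c..t, F t s := by
  rw [intervalIntegral.integral_of_le ht.1.le, setIntegral_indicator measurableSet_Iic,
    Ioc_inter_Iic, min_eq_right ht.2]

theorem setIntegral_indicator_Ici_eq_intervalIntegral {s : ℝ} (hs : s ∈ Ioc c d) :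
    ∫ t in Ioc c d, (Ici s).indicator (F · s) t = ∫ t in s..d, F t s := by
  have hinter : Ioc c d ∩ Ici s = Icc s d := by
    ext t
    exact ⟨fun h => ⟨h.2, h.1.2⟩, fun h => ⟨⟨hs.1.trans_le h.1, h.2⟩, h.1⟩⟩
  rw [setIntegral_indicator measurableSet_Ici, hinter, integral_Icc_eq_integral_Ioc,
    intervalIntegral.integral_of_le hs.2]

theorem intervalIntegrable_integral_triangle (hcd : c ≤ d)
    (hF : Integrable F.uncurry ((volume.restrict (Ioc c d)).prod (volume.restrict (Ioc c d)))) :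
    IntervalIntegrable (fun t => ∫ s in c..t, F t s) volume c d := by
  rw [intervalIntegrable_iff_integrableOn_Ioc_of_le hcd]
  refine (integrable_triangle hF).integral_prod_left.congr ?_
  filter_upwards [ae_restrict_mem measurableSet_Ioc] with t ht
  exact setIntegral_indicator_Iic_eq_intervalIntegral ht

theorem integral_triangle_swap (hcd : c ≤ d)
    (hF : Integrable F.uncurry ((volume.restrict (Ioc c d)).prod (volume.restrict (Ioc c d)))) :
    ∫ t in c..d, ∫ s in c..t, F t s = ∫ s in c..d, ∫ t in s..d, F t s := by
  rw [intervalIntegral.integral_of_le hcd, intervalIntegral.integral_of_le hcd]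
  calc ∫ t in Ioc c d, ∫ s in c..t, F t s
      = ∫ t in Ioc c d, ∫ s in Ioc c d, (Iic t).indicator (F t) s :=
        setIntegral_congr_fun measurableSet_Ioc fun _ ht =>
          (setIntegral_indicator_Iic_eq_intervalIntegral ht).symm
    _ = ∫ s in Ioc c d, ∫ t in Ioc c d, (Ici s).indicator (F · s) t := by
        rw [integral_integral_swap (integrable_triangle hF)]
        simp only [indicator, mem_Iic, mem_Ici]
    _ = ∫ s in Ioc c d, ∫ t in s..d, F t s :=
        setIntegral_congr_fun measurableSet_Ioc fun _ hs =>
          setIntegral_indicator_Ici_eq_intervalIntegral hs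

theorem integrable_uncurry_mul_of_continuous {Φ : ℝ → ℝ → ℂ} (hΦ : Continuous Φ.uncurry)
    {f : ℝ → ℂ} (hcd : c ≤ d) (hf : IntervalIntegrable f volume c d) :
    Integrable (Function.uncurry fun t s => Φ t s * f s)
      ((volume.restrict (Ioc c d)).prod (volume.restrict (Ioc c d))) := by
  obtain ⟨C, hC⟩ := (isCompact_Icc.prod isCompact_Icc : IsCompact
    (Icc c d ×ˢ Icc c d)).exists_bound_of_continuousOn hΦ.continuousOn
  refine (Integrable.comp_snd ((intervalIntegrable_iff_integrableOn_Ioc_of_le hcd).1 hf)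
    (volume.restrict (Ioc c d))).bdd_mul (c := C) hΦ.aestronglyMeasurable ?_
  rw [Measure.prod_restrict]
  filter_upwards [ae_restrict_mem (measurableSet_Ioc.prod measurableSet_Ioc)] with p hp
  exact hC p ⟨Ioc_subset_Icc_self hp.1, Ioc_subset_Icc_self hp.2⟩

end Triangle

section TestFunction

variable {c d : ℝ} {φ ψ : ℝ → ℂ}

theorem IsTestFunction.deriv (h : IsTestFunction c d φ) : IsTestFunction c d (deriv φ) where
  smooth := (contDiff_infty_iff_deriv.1 h.smooth).2
  compact := h.compact.deriv
  support := (closure_minimal support_deriv_subset (isClosed_tsupport φ)).trans h.support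

theorem IsTestFunction.iteratedDeriv (h : IsTestFunction c d φ) (n : ℕ) :
    IsTestFunction c d (_root_.iteratedDeriv n φ) := by
  induction n with
  | zero => rwa [iteratedDeriv_zero]
  | succ n ih => exact iteratedDeriv_succ (n := n) (f := φ) ▸ ih.deriv

theorem IsTestFunction.mono {c' d' : ℝ} (h : IsTestFunction c d φ) (hc : c' ≤ c) (hd : d ≤ d') :
    IsTestFunction c' d' φ :=
  ⟨h.smooth, h.compact, h.support.trans (Ioo_subset_Ioo hc hd)⟩

theorem IsTestFunction.eq_zero (h : IsTestFunction c d φ) {x : ℝ} (hx : x ∉ Ioo c d) : φ x = 0 :=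
  image_eq_zero_of_notMem_tsupport fun hx' => hx (h.support hx')

theorem IsTestFunction.differentiable (h : IsTestFunction c d φ) : Differentiable ℝ φ :=
  h.smooth.differentiable (by simp)

theorem IsTestFunction.hasDerivAt (h : IsTestFunction c d φ) (x : ℝ) :
    HasDerivAt φ (_root_.deriv φ x) x :=
  (h.differentiable x).hasDerivAt

theorem IsTestFunction.continuous (h : IsTestFunction c d φ) : Continuous φ :=
  h.smooth.continuous

theorem IsTestFunction.sub (hφ : IsTestFunction c d φ) (hψ : IsTestFunction c d ψ) :
    IsTestFunction c d (φ - ψ) where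
  smooth := hφ.smooth.sub hψ.smooth
  compact := hφ.compact.sub hψ.compact
  support := by
    have hsub : Function.support (φ - ψ) ⊆ tsupport φ ∪ tsupport ψ :=
      (Function.support_sub φ ψ).trans (union_subset_union subset_closure subset_closure)
    exact (closure_minimal hsub ((isClosed_tsupport φ).union (isClosed_tsupport ψ))).trans
      (union_subset hφ.support hψ.support)

theorem IsTestFunction.const_smul (h : IsTestFunction c d φ) (k : ℂ) :
    IsTestFunction c d (k • φ) where
  smooth := h.smooth.const_smul k
  compact := h.compact.smul_left
  support := (tsupport_smul_subset_right (fun _ => k) φ).trans h.support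

theorem IsTestFunction.ofReal {g : ℝ → ℝ} (hg : ContDiff ℝ ∞ g) (hc : HasCompactSupport g)
    (hs : tsupport g ⊆ Ioo c d) : IsTestFunction c d (fun x => (g x : ℂ)) where
  smooth := Complex.ofRealCLM.contDiff.comp hg
  compact := hc.comp_left (g := fun r : ℝ => (r : ℂ)) (by simp)
  support := (tsupport_comp_subset (g := fun r : ℝ => (r : ℂ)) (by simp) g).trans hs

theorem IsTestFunction.integral_Ioo_mul {c' d' : ℝ} (h : IsTestFunction c d φ) (hc : c' ≤ c)
    (hd : d ≤ d') (f : ℝ → ℂ) : ∫ x in Ioo c' d', f x * φ x = ∫ x in Ioo c d, f x * φ x :=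
  setIntegral_eq_of_subset_of_forall_sdiff_eq_zero measurableSet_Ioo (Ioo_subset_Ioo hc hd)
    fun x hx => by rw [h.eq_zero hx.2, mul_zero]

theorem IsTestFunction.integrableOn_mul {s : Set ℝ} {f : ℝ → ℂ} (h : IsTestFunction c d φ)
    (hf : IntegrableOn f s) : IntegrableOn (fun x => f x * φ x) s := by
  obtain ⟨C, hC⟩ := h.compact.exists_bound_of_continuous h.continuous
  exact Integrable.mul_bdd (c := C) hf h.continuous.aestronglyMeasurable (ae_of_all _ hC)

theorem IsTestFunction.exists_tsupport_subset_Icc (hcd : c < d) (h : IsTestFunction c d φ) :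
    ∃ p q, c < p ∧ q < d ∧ tsupport φ ⊆ Icc p q := by
  rcases (tsupport φ).eq_empty_or_nonempty with he | hne
  · obtain ⟨x, hcx, hxd⟩ := exists_between hcd
    exact ⟨x, x, hcx, hxd, by simp [he]⟩
  · exact ⟨_, _, (h.support (h.compact.isCompact.sInf_mem hne)).1,
      (h.support (h.compact.isCompact.sSup_mem hne)).2,
      fun x hx => ⟨csInf_le h.compact.isCompact.bddBelow hx,
        le_csSup h.compact.isCompact.bddAbove hx⟩⟩

theorem IsTestFunction.tsupport_integral_subset {p q : ℝ} (h : IsTestFunction c d φ)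
    (hcp : c < p) (hqd : q < d) (hs : tsupport φ ⊆ Icc p q) (h0 : ∫ x in c..d, φ x = 0) :
    tsupport (fun x => ∫ t in c..x, φ t) ⊆ Icc p q := by
  have hφ {x : ℝ} (hx : x ∉ Icc p q) : φ x = 0 :=
    image_eq_zero_of_notMem_tsupport fun hx' => hx (hs hx')
  refine closure_minimal (fun x hx => ?_) isClosed_Icc
  by_contra hx'
  refine hx ?_
  rcases not_and_or.1 hx' with hxp | hqx
  · refine intervalIntegral.integral_zero_ae (ae_of_all _ fun t ht => hφ fun ht' => ?_)
    exact (ht.2.trans_lt (max_lt hcp (not_le.1 hxp))).not_ge ht'.1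
  · have hright : ∫ t in x..d, φ t = 0 := by
      refine intervalIntegral.integral_zero_ae (ae_of_all _ fun t ht => hφ fun ht' => ?_)
      exact ((lt_min (not_le.1 hqx) hqd).trans ht.1).not_ge ht'.2
    rw [← h0, ← intervalIntegral.integral_add_adjacent_intervals
      (h.continuous.intervalIntegrable (μ := volume) c x) (h.continuous.intervalIntegrable x d),
      hright, add_zero]

theorem IsTestFunction.integral_of_integral_eq_zero (hcd : c < d) (h : IsTestFunction c d φ)
    (h0 : ∫ x in c..d, φ x = 0) : IsTestFunction c d (fun x => ∫ t in c..x, φ t) := by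
  obtain ⟨p, q, hcp, hqd, hs⟩ := h.exists_tsupport_subset_Icc hcd
  have hsupp := h.tsupport_integral_subset hcp hqd hs h0
  refine ⟨?_, .of_support_subset_isCompact isCompact_Icc (subset_closure.trans hsupp),
    hsupp.trans (Icc_subset_Ioo hcp hqd)⟩
  have hderiv (x : ℝ) : HasDerivAt (fun x => ∫ t in c..x, φ t) (φ x) x :=
    (h.continuous.integral_hasStrictDerivAt c x).hasDerivAt
  rw [contDiff_infty_iff_deriv, funext fun x => (hderiv x).deriv]
  exact ⟨fun x => (hderiv x).differentiableAt, h.smooth⟩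

theorem exists_isTestFunction_integral_eq_one (hcd : c < d) :
    ∃ η, IsTestFunction c d η ∧ ∫ x in Ioo c d, η x = 1 := by
  let b : ContDiffBump ((c + d) / 2) := ⟨(d - c) / 8, (d - c) / 4, by linarith, by linarith⟩
  have hs : tsupport (b.normed volume) ⊆ Ioo c d := by
    rw [b.tsupport_normed_eq, Real.closedBall_eq_Icc]
    exact Icc_subset_Ioo (by simp only [b]; linarith) (by simp only [b]; linarith)
  have hη : IsTestFunction c d (fun x => (b.normed volume x : ℂ)) :=
    .ofReal b.contDiff_normed b.hasCompactSupport_normed hs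
  refine ⟨_, hη, ?_⟩
  rw [setIntegral_eq_integral_of_forall_compl_eq_zero fun x hx => hη.eq_zero hx,
    integral_complex_ofReal, b.integral_normed, Complex.ofReal_one]

theorem ae_eq_zero_of_forall_isTestFunction {f : ℝ → ℂ} (hf : IntegrableOn f (Ioo c d))
    (h : ∀ φ, IsTestFunction c d φ → ∫ x in Ioo c d, f x * φ x = 0) :
    ∀ᵐ x ∂(volume.restrict (Ioo c d)), f x = 0 := by
  rw [ae_restrict_iff' measurableSet_Ioo]
  refine IsOpen.ae_eq_zero_of_integral_contDiff_smul_eq_zero isOpen_Ioo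
    hf.locallyIntegrableOn fun g hg hgc hgs => ?_
  have hφ := IsTestFunction.ofReal hg hgc hgs
  rw [← h _ hφ, ← setIntegral_eq_integral_of_forall_compl_eq_zero (s := Ioo c d)]
  · exact integral_congr_ae (ae_of_all _ fun x => by simp [mul_comm])
  · intro x hx
    rw [Complex.ofReal_eq_zero.1 (hφ.eq_zero hx), zero_smul]

end TestFunction

section MemL2

variable {c d : ℝ} {f : ℝ → ℂ}

theorem MemL2.integrableOn (h : MemL2 c d f) : IntegrableOn f (Ioo c d) :=
  MemLp.integrable one_le_two h

theorem MemL2.mono {c' d' : ℝ} (h : MemL2 c d f) (hc : c ≤ c') (hd : d' ≤ d) : MemL2 c' d' f :=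
  MemLp.mono_measure (Measure.restrict_mono (Ioo_subset_Ioo hc hd) le_rfl) h

theorem memL2_of_continuousOn (h : ContinuousOn f (Icc c d)) : MemL2 c d f := by
  obtain ⟨C, hC⟩ := isCompact_Icc.exists_bound_of_continuousOn h
  refine MemLp.of_bound ((h.mono Ioo_subset_Icc_self).aestronglyMeasurable measurableSet_Ioo) C ?_
  filter_upwards [ae_restrict_mem measurableSet_Ioo] with x hx
  exact hC x (Ioo_subset_Icc_self hx)

end MemL2

section IsPrimitiveOn

variable {E : Type*} [NormedAddCommGroup E] [NormedSpace ℝ E] {c d : ℝ} {f g : ℝ → E}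

/-- `f` is an indefinite integral of `g` on `[c, d]`, that is, `f` is absolutely continuous there
with almost everywhere derivative `g`. -/
structure IsPrimitiveOn (c d : ℝ) (f g : ℝ → E) : Prop where
  intervalIntegrable : IntervalIntegrable g volume c d
  eq_add_integral : ∀ x ∈ Icc c d, f x = f c + ∫ t in c..x, g t

theorem IsPrimitiveOn.continuousOn (h : IsPrimitiveOn c d f g) : ContinuousOn f (Icc c d) :=
  ((continuousOn_const.add (intervalIntegral.continuousOn_primitive_interval'
    h.intervalIntegrable left_mem_uIcc)).mono Icc_subset_uIcc).congr h.eq_add_integral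

theorem IsPrimitiveOn.congr (h : IsPrimitiveOn c d f g) {f' g' : ℝ → E} (hcd : c ≤ d)
    (hf : EqOn f f' (Icc c d)) (hg : ∀ᵐ x ∂(volume.restrict (Ioo c d)), g x = g' x) :
    IsPrimitiveOn c d f' g' where
  intervalIntegrable := by
    have hgi := h.intervalIntegrable
    rw [intervalIntegrable_iff_integrableOn_Ioo_of_le hcd] at hgi ⊢
    exact hgi.congr hg
  eq_add_integral x hx := by
    rw [← hf hx, ← hf (left_mem_Icc.2 hcd), h.eq_add_integral x hx,
      intervalIntegral.integral_of_le hx.1, intervalIntegral.integral_of_le hx.1,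
      integral_Ioc_eq_integral_Ioo, integral_Ioc_eq_integral_Ioo]
    exact congrArg (f c + ·) (integral_congr_ae
      (ae_mono (Measure.restrict_mono (Ioo_subset_Ioo_right hx.2) le_rfl) hg))

theorem IsPrimitiveOn.union {ξ : ℝ} (hl : IsPrimitiveOn c ξ f g) (hr : IsPrimitiveOn ξ d f g)
    (hcξ : c ≤ ξ) : IsPrimitiveOn c d f g where
  intervalIntegrable := hl.intervalIntegrable.trans hr.intervalIntegrable
  eq_add_integral x hx := by
    rcases le_total x ξ with hxξ | hξx
    · exact hl.eq_add_integral x ⟨hx.1, hxξ⟩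
    · rw [hr.eq_add_integral x ⟨hξx, hx.2⟩, hl.eq_add_integral ξ ⟨hcξ, le_rfl⟩, add_assoc,
        intervalIntegral.integral_add_adjacent_intervals hl.intervalIntegrable
          (hr.intervalIntegrable.mono_set
            (uIcc_subset_uIcc_left (Icc_subset_uIcc ⟨hξx, hx.2⟩)))]

theorem isPrimitiveOn_integral (hg : IntervalIntegrable g volume c d) :
    IsPrimitiveOn c d (fun x => ∫ t in c..x, g t) g :=
  ⟨hg, fun x _ => by rw [intervalIntegral.integral_same, zero_add]⟩

variable [CompleteSpace E]

theorem isPrimitiveOn_of_hasDerivAt (h : ∀ x, HasDerivAt f (g x) x) (hg : Continuous g)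
    (c d : ℝ) : IsPrimitiveOn c d f g where
  intervalIntegrable := hg.intervalIntegrable c d
  eq_add_integral x _ := by
    rw [intervalIntegral.integral_eq_sub_of_hasDerivAt (fun y _ => h y)
      (hg.intervalIntegrable c x), add_sub_cancel]

theorem IsPrimitiveOn.hasDerivWithinAt (h : IsPrimitiveOn c d f g)
    (hg : ContinuousOn g (Icc c d)) {x : ℝ} (hx : x ∈ Icc c d) :
    HasDerivWithinAt f (g x) (Icc c d) x := by
  have : Fact (x ∈ Icc c d) := ⟨hx⟩
  have hint : HasDerivWithinAt (fun y => ∫ t in c..y, g t) (g x) (Icc c d) x :=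
    intervalIntegral.integral_hasDerivWithinAt_right
      (h.intervalIntegrable.mono_set (uIcc_subset_uIcc_left (Icc_subset_uIcc hx)))
      (hg.stronglyMeasurableAtFilter_nhdsWithin measurableSet_Icc x) (hg x hx)
  exact (hint.const_add (f c)).congr h.eq_add_integral (h.eq_add_integral x hx)

end IsPrimitiveOn

section IntegrationByParts

variable {c d : ℝ} {f g φ : ℝ → ℂ}

theorem IsPrimitiveOn.integral_mul_deriv (h : IsPrimitiveOn c d f g) (hcd : c ≤ d) {φ' : ℝ → ℂ}
    (hφ : ∀ x, HasDerivAt φ (φ' x) x) (hφ' : Continuous φ') :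
    ∫ x in c..d, f x * φ' x = f d * φ d - f c * φ c - ∫ x in c..d, g x * φ x := by
  have hcont : Continuous φ := continuous_iff_continuousAt.2 fun x => (hφ x).continuousAt
  have hFTC (s : ℝ) : ∫ t in s..d, φ' t = φ d - φ s :=
    intervalIntegral.integral_eq_sub_of_hasDerivAt (fun x _ => hφ x)
      (hφ'.intervalIntegrable s d)
  have hF := integrable_uncurry_mul_of_continuous (Φ := fun t _ => φ' t)
    (hφ'.comp continuous_fst) hcd h.intervalIntegrable
  calc ∫ x in c..d, f x * φ' x
      = ∫ t in c..d, (f c * φ' t + ∫ s in c..t, φ' t * g s) := by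
        refine intervalIntegral.integral_congr fun t ht => ?_
        rw [uIcc_of_le hcd] at ht
        simp only [intervalIntegral.integral_const_mul, h.eq_add_integral t ht]
        ring
    _ = f c * (φ d - φ c) + ∫ s in c..d, (φ d * g s - g s * φ s) := by
        rw [intervalIntegral.integral_add ((hφ'.intervalIntegrable c d).const_mul _)
          (intervalIntegrable_integral_triangle hcd hF), integral_triangle_swap hcd hF,
          intervalIntegral.integral_const_mul, hFTC]
        simp only [intervalIntegral.integral_mul_const, hFTC, sub_mul, mul_comm (g _)]
    _ = f d * φ d - f c * φ c - ∫ x in c..d, g x * φ x := by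
        rw [intervalIntegral.integral_sub (h.intervalIntegrable.const_mul _)
          (h.intervalIntegrable.mul_continuousOn hcont.continuousOn),
          intervalIntegral.integral_const_mul, h.eq_add_integral d (right_mem_Icc.2 hcd)]
        ring

theorem setIntegral_Ioo_eq_intervalIntegral (hcd : c ≤ d) :
    ∫ x in Ioo c d, f x = ∫ x in c..d, f x := by
  rw [intervalIntegral.integral_of_le hcd, integral_Ioc_eq_integral_Ioo]

theorem IsPrimitiveOn.setIntegral_mul_deriv {p q : ℝ} (h : IsPrimitiveOn c d f g) (hcd : c ≤ d)
    (hφ : IsTestFunction p q φ) :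
    ∫ x in Ioo c d, f x * deriv φ x
      = f d * φ d - f c * φ c - ∫ x in Ioo c d, g x * φ x := by
  rw [setIntegral_Ioo_eq_intervalIntegral hcd, setIntegral_Ioo_eq_intervalIntegral hcd]
  exact h.integral_mul_deriv hcd hφ.hasDerivAt hφ.deriv.continuous

theorem IsPrimitiveOn.hasWeakDeriv (h : IsPrimitiveOn c d f g) (hcd : c ≤ d) :
    HasWeakDeriv c d f g := fun φ hφ => by
  rw [h.setIntegral_mul_deriv hcd hφ, hφ.eq_zero left_notMem_Ioo, hφ.eq_zero right_notMem_Ioo]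
  ring

theorem IsPrimitiveOn.setIntegral_mul_deriv_add {ξ : ℝ} {k k' : ℝ → ℂ}
    (hf : IsPrimitiveOn c ξ f g) (hk : IsPrimitiveOn ξ d k k') (hcξ : c ≤ ξ) (hξd : ξ ≤ d)
    (hφ : IsTestFunction c d φ) :
    (∫ x in Ioo c ξ, f x * deriv φ x) + ∫ x in Ioo ξ d, k x * deriv φ x
      = (f ξ - k ξ) * φ ξ - ((∫ x in Ioo c ξ, g x * φ x) + ∫ x in Ioo ξ d, k' x * φ x) := by
  rw [hf.setIntegral_mul_deriv hcξ hφ, hk.setIntegral_mul_deriv hξd hφ,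
    hφ.eq_zero left_notMem_Ioo, hφ.eq_zero right_notMem_Ioo]
  ring

end IntegrationByParts

section HasWeakDeriv

variable {c d : ℝ} {f g : ℝ → ℂ}

theorem HasWeakDeriv.add {f' g' : ℝ → ℂ} (hf : HasWeakDeriv c d f f') (hg : HasWeakDeriv c d g g')
    (hfi : IntegrableOn f (Ioo c d)) (hfi' : IntegrableOn f' (Ioo c d))
    (hgi : IntegrableOn g (Ioo c d)) (hgi' : IntegrableOn g' (Ioo c d)) :
    HasWeakDeriv c d (f + g) (f' + g') := fun φ hφ => by
  simp only [Pi.add_apply, add_mul]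
  rw [integral_add (hφ.deriv.integrableOn_mul hfi) (hφ.deriv.integrableOn_mul hgi),
    integral_add (hφ.integrableOn_mul hfi') (hφ.integrableOn_mul hgi'), hf φ hφ, hg φ hφ,
    neg_add]

theorem HasWeakDeriv.const_smul {f' : ℝ → ℂ} (hf : HasWeakDeriv c d f f') (k : ℂ) :
    HasWeakDeriv c d (k • f) (k • f') := fun φ hφ => by
  simp only [Pi.smul_apply, smul_eq_mul, mul_assoc, integral_const_mul]
  rw [hf φ hφ, mul_neg]

theorem HasWeakDeriv.mono {c' d' : ℝ} (h : HasWeakDeriv c d f g) (hc : c ≤ c') (hd : d' ≤ d) :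
    HasWeakDeriv c' d' f g := fun φ hφ => by
  rw [← hφ.deriv.integral_Ioo_mul hc hd, ← hφ.integral_Ioo_mul hc hd]
  exact h φ (hφ.mono hc hd)

theorem HasWeakDeriv.ae_eq_const (hcd : c < d) (h : HasWeakDeriv c d f 0)
    (hf : IntegrableOn f (Ioo c d)) :
    ∃ k : ℂ, ∀ᵐ x ∂(volume.restrict (Ioo c d)), f x = k := by
  obtain ⟨η, hη, hη1⟩ := exists_isTestFunction_integral_eq_one hcd
  have hint {k : ℝ → ℂ} (hk : Continuous k) : IntegrableOn k (Ioo c d) :=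
    (memL2_of_continuousOn hk.continuousOn).integrableOn
  set k := ∫ x in Ioo c d, f x * η x with hk
  suffices hzero : ∀ᵐ x ∂(volume.restrict (Ioo c d)), f x - k = 0 from
    ⟨k, hzero.mono fun _ hx => sub_eq_zero.1 hx⟩
  refine ae_eq_zero_of_forall_isTestFunction (hf.sub (hint continuous_const)) fun φ hφ => ?_
  -- `φ - m η` has integral zero, hence is the derivative of a test function.
  set m := ∫ x in Ioo c d, φ x
  have hχ : IsTestFunction c d (φ - m • η) := hφ.sub (hη.const_smul m)
  have hχ0 : ∫ x in c..d, (φ - m • η) x = 0 := by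
    rw [← setIntegral_Ioo_eq_intervalIntegral hcd.le]
    simp only [Pi.sub_apply, Pi.smul_apply, smul_eq_mul]
    rw [integral_sub (hint hφ.continuous) ((hint hη.continuous).const_mul m),
      integral_const_mul, hη1, mul_one, sub_self]
  have hfχ : ∫ x in Ioo c d, f x * (φ - m • η) x = 0 := by
    have hweak := h _ (hχ.integral_of_integral_eq_zero hcd hχ0)
    simpa only [hχ.continuous.deriv_integral, Pi.zero_apply, zero_mul, integral_zero, neg_zero]
      using hweak
  calc ∫ x in Ioo c d, (f x - k) * φ x
      = (∫ x in Ioo c d, f x * φ x) - k * m := by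
        simp only [sub_mul]
        rw [integral_sub (hφ.integrableOn_mul hf) ((hint hφ.continuous).const_mul k),
          integral_const_mul]
    _ = ∫ x in Ioo c d, f x * (φ - m • η) x := by
        rw [hk, mul_comm, ← integral_const_mul, ← integral_sub (hφ.integrableOn_mul hf)
          ((hη.integrableOn_mul hf).const_mul m)]
        exact integral_congr_ae (ae_of_all _ fun x => by
          simp only [Pi.sub_apply, Pi.smul_apply, smul_eq_mul]; ring)
    _ = 0 := hfχ

theorem eqOn_Icc_of_ae_eq_Ioo {X : Type*} [TopologicalSpace X] [T2Space X] (hcd : c < d)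
    {f g : ℝ → X} (hf : ContinuousOn f (Icc c d)) (hg : ContinuousOn g (Icc c d))
    (h : ∀ᵐ x ∂(volume.restrict (Ioo c d)), f x = g x) : EqOn f g (Icc c d) :=
  (Measure.eqOn_open_of_ae_eq h isOpen_Ioo (hf.mono Ioo_subset_Icc_self)
    (hg.mono Ioo_subset_Icc_self)).of_subset_closure hf hg Ioo_subset_Icc_self
    (closure_Ioo hcd.ne).ge

/-- The du Bois-Reymond lemma. -/
theorem HasWeakDeriv.isPrimitiveOn (hcd : c < d) (h : HasWeakDeriv c d f g)
    (hf : ContinuousOn f (Icc c d)) (hg : IntegrableOn g (Ioo c d)) : IsPrimitiveOn c d f g := by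
  have hgi : IntervalIntegrable g volume c d :=
    (intervalIntegrable_iff_integrableOn_Ioo_of_le hcd.le).2 hg
  set G : ℝ → ℂ := fun x => ∫ t in c..x, g t
  have hG : IsPrimitiveOn c d G g := isPrimitiveOn_integral hgi
  have hcont : ContinuousOn (f + (-1 : ℂ) • G) (Icc c d) :=
    hf.add (hG.continuousOn.const_smul _)
  have hint {k : ℝ → ℂ} (hk : ContinuousOn k (Icc c d)) : IntegrableOn k (Ioo c d) :=
    (memL2_of_continuousOn hk).integrableOn
  have hweak : HasWeakDeriv c d (f + (-1 : ℂ) • G) 0 := by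
    simpa using h.add ((hG.hasWeakDeriv hcd.le).const_smul (-1)) (hint hf) hg
      ((hint hG.continuousOn).smul (-1 : ℂ)) (hg.smul (-1 : ℂ))
  obtain ⟨k, hk⟩ := hweak.ae_eq_const hcd (hint hcont)
  have heq := eqOn_Icc_of_ae_eq_Ioo hcd hcont continuousOn_const hk
  refine ⟨hgi, fun x hx => ?_⟩
  have hx' := heq hx
  have hc' := heq (left_mem_Icc.2 hcd.le)
  simp only [G, Pi.add_apply, Pi.smul_apply, smul_eq_mul, intervalIntegral.integral_same]
    at hx' hc'
  linear_combination hx' - hc'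

end HasWeakDeriv

namespace IsSobolevDerivs

variable {m : ℕ} {c d : ℝ} {u w : ℝ → ℂ} {D E : ℕ → ℝ → ℂ}

theorem isPrimitiveOn (h : IsSobolevDerivs m c d u D) (hcd : c < d) {j : ℕ} (hj : j < m) :
    IsPrimitiveOn c d (D j) (D (j + 1)) :=
  (h.deriv j hj).isPrimitiveOn hcd (h.cont j hj) (h.memL2 (j + 1) hj).integrableOn

theorem of_isPrimitiveOn (hcd : c ≤ d) (htop : MemL2 c d (D m))
    (hD : ∀ j < m, IsPrimitiveOn c d (D j) (D (j + 1))) : IsSobolevDerivs m c d (D 0) D where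
  zero _ _ := rfl
  cont j hj := (hD j hj).continuousOn
  memL2 j hj := hj.lt_or_eq.elim (fun hj => memL2_of_continuousOn (hD j hj).continuousOn)
    fun hj => hj ▸ htop
  deriv j hj := (hD j hj).hasWeakDeriv hcd

theorem of_hasDerivAt (hD : ∀ j x, HasDerivAt (D j) (D (j + 1) x) x) (m : ℕ) (hcd : c ≤ d) :
    IsSobolevDerivs m c d (D 0) D :=
  have hcont (j : ℕ) : Continuous (D j) :=
    continuous_iff_continuousAt.2 fun x => (hD j x).continuousAt
  of_isPrimitiveOn hcd (memL2_of_continuousOn (hcont m).continuousOn) fun j _ =>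
    isPrimitiveOn_of_hasDerivAt (hD j) (hcont (j + 1)) c d

theorem congr (h : IsSobolevDerivs m c d u D) (huw : EqOn u w (Icc c d)) :
    IsSobolevDerivs m c d w D :=
  { h with zero := fun x hx => (h.zero x hx).trans (huw hx) }

theorem mono_order (h : IsSobolevDerivs m c d u D) {n : ℕ} (hn : n ≤ m) :
    IsSobolevDerivs n c d u D where
  zero := h.zero
  cont j hj := h.cont j (hj.trans_le hn)
  memL2 j hj := h.memL2 j (hj.trans hn)
  deriv j hj := h.deriv j (hj.trans_le hn)

theorem mono (h : IsSobolevDerivs m c d u D) {c' d' : ℝ} (hc : c ≤ c') (hd : d' ≤ d) :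
    IsSobolevDerivs m c' d' u D where
  zero x hx := h.zero x (Icc_subset_Icc hc hd hx)
  cont j hj := (h.cont j hj).mono (Icc_subset_Icc hc hd)
  memL2 j hj := (h.memL2 j hj).mono hc hd
  deriv j hj := (h.deriv j hj).mono hc hd

theorem add (hD : IsSobolevDerivs m c d u D) (hE : IsSobolevDerivs m c d w E) :
    IsSobolevDerivs m c d (u + w) (D + E) where
  zero x hx := congrArg₂ (· + ·) (hD.zero x hx) (hE.zero x hx)
  cont j hj := (hD.cont j hj).add (hE.cont j hj)
  memL2 j hj := MemLp.add (hD.memL2 j hj) (hE.memL2 j hj)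
  deriv j hj := (hD.deriv j hj).add (hE.deriv j hj) (hD.memL2 j hj.le).integrableOn
    (hD.memL2 (j + 1) hj).integrableOn (hE.memL2 j hj.le).integrableOn
    (hE.memL2 (j + 1) hj).integrableOn

theorem const_smul (h : IsSobolevDerivs m c d u D) (k : ℂ) :
    IsSobolevDerivs m c d (k • u) (k • D) where
  zero x hx := congrArg (k • ·) (h.zero x hx)
  cont j hj := (h.cont j hj).const_smul k
  memL2 j hj := MemLp.const_smul (h.memL2 j hj) k
  deriv j hj := (h.deriv j hj).const_smul k

theorem sub (hD : IsSobolevDerivs m c d u D) (hE : IsSobolevDerivs m c d w E) :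
    IsSobolevDerivs m c d (u - w) (D - E) := by
  simpa only [neg_one_smul, ← sub_eq_add_neg] using hD.add (hE.const_smul (-1))

theorem hasDerivWithinAt (h : IsSobolevDerivs m c d u D) (hcd : c < d) {j : ℕ} (hj : j + 1 < m)
    {x : ℝ} (hx : x ∈ Icc c d) : HasDerivWithinAt (D j) (D (j + 1) x) (Icc c d) x :=
  (h.isPrimitiveOn hcd (by omega)).hasDerivWithinAt (h.cont (j + 1) hj) hx

theorem eqOn_of_lt (hD : IsSobolevDerivs m c d u D) (hE : IsSobolevDerivs m c d u E)
    (hcd : c < d) {j : ℕ} (hj : j < m) : EqOn (D j) (E j) (Icc c d) := by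
  induction j with
  | zero => exact fun x hx => (hD.zero x hx).trans (hE.zero x hx).symm
  | succ j ih =>
    intro x hx
    have heq := ih (by omega)
    exact (uniqueDiffOn_Icc hcd x hx).eq_deriv _ (hD.hasDerivWithinAt hcd hj hx)
      ((hE.hasDerivWithinAt hcd hj hx).congr heq (heq hx))

theorem integral_mul_iteratedDeriv (h : IsSobolevDerivs m c d u D) {φ : ℝ → ℂ}
    (hφ : IsTestFunction c d φ) :
    ∫ x in Ioo c d, u x * iteratedDeriv m φ x = (-1) ^ m * ∫ x in Ioo c d, D m x * φ x := by
  induction m generalizing φ with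
  | zero =>
    rw [iteratedDeriv_zero, pow_zero, one_mul]
    exact setIntegral_congr_fun measurableSet_Ioo fun x hx => by
      simp only [h.zero x (Ioo_subset_Icc_self hx)]
  | succ m ih =>
    rw [iteratedDeriv_succ', ih (h.mono_order m.le_succ) hφ.deriv, h.deriv m m.lt_succ_self φ hφ,
      pow_succ]
    ring

end IsSobolevDerivs

section Gluing

variable {n : ℕ} {c ξ d : ℝ} {u : ℝ → ℂ} {l r : ℕ → ℝ → ℂ}

theorem setIntegral_Ioo_add_adjacent {f : ℝ → ℂ} (hcξ : c ≤ ξ) (hξd : ξ ≤ d)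
    (hf : IntegrableOn f (Ioo c ξ)) (hf' : IntegrableOn f (Ioo ξ d)) :
    ∫ x in Ioo c d, f x = (∫ x in Ioo c ξ, f x) + ∫ x in Ioo ξ d, f x := by
  rw [setIntegral_Ioo_eq_intervalIntegral (hcξ.trans hξd), setIntegral_Ioo_eq_intervalIntegral hcξ,
    setIntegral_Ioo_eq_intervalIntegral hξd, intervalIntegral.integral_add_adjacent_intervals
      ((intervalIntegrable_iff_integrableOn_Ioo_of_le hcξ).2 hf)
      ((intervalIntegrable_iff_integrableOn_Ioo_of_le hξd).2 hf')]

theorem integral_mul_iteratedDeriv_of_pieces {φ : ℝ → ℂ} (hl : IsSobolevDerivs n c ξ u l)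
    (hr : IsSobolevDerivs n ξ d u r) (hcξ : c < ξ) (hξd : ξ < d) (hφ : IsTestFunction c d φ)
    (hmatch : ∀ j < n, l j ξ = r j ξ) :
    ∫ x in Ioo c d, u x * iteratedDeriv n φ x
      = (-1) ^ n * ((∫ x in Ioo c ξ, l n x * φ x) + ∫ x in Ioo ξ d, r n x * φ x) := by
  induction n generalizing φ with
  | zero =>
    have hul : EqOn (l 0) u (Ioo c ξ) := fun x hx => hl.zero x (Ioo_subset_Icc_self hx)
    have hur : EqOn (r 0) u (Ioo ξ d) := fun x hx => hr.zero x (Ioo_subset_Icc_self hx)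
    have hli := (hl.memL2 0 le_rfl).integrableOn.congr_fun hul measurableSet_Ioo
    have hri := (hr.memL2 0 le_rfl).integrableOn.congr_fun hur measurableSet_Ioo
    rw [iteratedDeriv_zero, pow_zero, one_mul, setIntegral_Ioo_add_adjacent hcξ.le hξd.le
      (hφ.integrableOn_mul hli) (hφ.integrableOn_mul hri)]
    exact congrArg₂ (· + ·)
      (setIntegral_congr_fun measurableSet_Ioo fun x hx => congrArg (· * φ x) (hul hx).symm)
      (setIntegral_congr_fun measurableSet_Ioo fun x hx => congrArg (· * φ x) (hur hx).symm)
  | succ n ih =>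
    rw [iteratedDeriv_succ', ih (hl.mono_order n.le_succ) (hr.mono_order n.le_succ) hφ.deriv
        fun j hj => hmatch j (hj.trans n.lt_succ_self),
      (hl.isPrimitiveOn hcξ n.lt_succ_self).setIntegral_mul_deriv_add
        (hr.isPrimitiveOn hξd n.lt_succ_self) hcξ.le hξd.le hφ, hmatch n n.lt_succ_self]
    ring

theorem integral_mul_iteratedDeriv_of_pieces_jump {φ : ℝ → ℂ} (hl : IsSobolevDerivs (n + 1) c ξ u l)
    (hr : IsSobolevDerivs (n + 1) ξ d u r) (hcξ : c < ξ) (hξd : ξ < d) (hφ : IsTestFunction c d φ)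
    (hmatch : ∀ j < n, l j ξ = r j ξ) :
    ∫ x in Ioo c d, u x * iteratedDeriv (n + 1) φ x
      = (-1) ^ n * ((l n ξ - r n ξ) * φ ξ
        - ((∫ x in Ioo c ξ, l (n + 1) x * φ x) + ∫ x in Ioo ξ d, r (n + 1) x * φ x)) := by
  rw [iteratedDeriv_succ', integral_mul_iteratedDeriv_of_pieces (hl.mono_order n.le_succ)
      (hr.mono_order n.le_succ) hcξ hξd hφ.deriv hmatch,
    (hl.isPrimitiveOn hcξ n.lt_succ_self).setIntegral_mul_deriv_add
      (hr.isPrimitiveOn hξd n.lt_succ_self) hcξ.le hξd.le hφ]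

theorem memSobolev_of_pieces (hl : IsSobolevDerivs n c ξ u l) (hr : IsSobolevDerivs n ξ d u r)
    (hcξ : c < ξ) (hξd : ξ < d) (hmatch : ∀ j < n, l j ξ = r j ξ) : MemSobolev n c d u := by
  set D : ℕ → ℝ → ℂ := fun j => (Iic ξ).piecewise (l j) (r j)
  have hDl (j : ℕ) : EqOn (l j) (D j) (Icc c ξ) := fun x hx =>
    (piecewise_eq_of_mem (Iic ξ) _ _ (mem_Iic.2 hx.2)).symm
  have hDr (j : ℕ) : EqOn (r j) (D j) (Ioc ξ d) := fun x hx =>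
    (piecewise_eq_of_notMem (Iic ξ) _ _ hx.1.not_ge).symm
  have hDr' {j : ℕ} (hj : j < n) : EqOn (r j) (D j) (Icc ξ d) := fun x hx => by
    rcases hx.1.eq_or_lt with rfl | hξx
    · exact (hmatch j hj).symm.trans (hDl j ⟨hcξ.le, le_rfl⟩)
    · exact hDr j ⟨hξx, hx.2⟩
  have hD (j : ℕ) (hj : j < n) : IsPrimitiveOn c d (D j) (D (j + 1)) :=
    ((hl.isPrimitiveOn hcξ hj).congr hcξ.le (hDl j) (ae_restrict_of_forall_mem measurableSet_Ioo
      fun x hx => hDl _ (Ioo_subset_Icc_self hx))).union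
    ((hr.isPrimitiveOn hξd hj).congr hξd.le (hDr' hj) (ae_restrict_of_forall_mem measurableSet_Ioo
      fun x hx => hDr _ (Ioo_subset_Ioc_self hx))) hcξ.le
  have htop : MemL2 c d (D n) := by
    refine MemLp.piecewise measurableSet_Iic (MemLp.mono_measure ?_ (hl.memL2 n le_rfl))
      (MemLp.mono_measure ?_ (hr.memL2 n le_rfl))
    · rw [Measure.restrict_restrict measurableSet_Iic, restrict_Ioo_eq_restrict_Ioc]
      exact Measure.restrict_mono (show Iic ξ ∩ Ioo c d ⊆ Ioc c ξ from fun x hx => ⟨hx.2.1, hx.1⟩)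
        le_rfl
    · rw [Measure.restrict_restrict measurableSet_Iic.compl]
      exact Measure.restrict_mono (show (Iic ξ)ᶜ ∩ Ioo c d ⊆ Ioo ξ d from
        fun x hx => ⟨not_le.1 hx.1, hx.2.2⟩) le_rfl
  refine ⟨D, (IsSobolevDerivs.of_isPrimitiveOn (hcξ.trans hξd).le htop hD).congr fun x hx => ?_⟩
  rcases le_or_gt x ξ with hxξ | hξx
  · exact (hDl 0 ⟨hx.1, hxξ⟩).symm.trans (hl.zero x ⟨hx.1, hxξ⟩)
  · exact (hDr 0 ⟨hξx, hx.2⟩).symm.trans (hr.zero x ⟨hξx.le, hx.2⟩)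

theorem IsSobolevDerivs.pieces_eq {D : ℕ → ℝ → ℂ} (hD : IsSobolevDerivs n c d u D)
    (hl : IsSobolevDerivs n c ξ u l) (hr : IsSobolevDerivs n ξ d u r) (hcξ : c < ξ) (hξd : ξ < d)
    {j : ℕ} (hj : j < n) : l j ξ = r j ξ :=
  (hl.eqOn_of_lt (hD.mono le_rfl hξd.le) hcξ hj (right_mem_Icc.2 hcξ.le)).trans
    (hr.eqOn_of_lt (hD.mono hcξ.le le_rfl) hξd hj (left_mem_Icc.2 hξd.le)).symm

end Gluing

section InitialValueProblem

variable {n : ℕ} {c d : ℝ} {κ : ℂ} {u w g : ℝ → ℂ} {D E : ℕ → ℝ → ℂ}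

/-- Gronwall's inequality for the vector `(D 0, …, D n)`. -/
theorem IsSobolevDerivs.eqOn_zero_of_ode (hcd : c < d) (h : IsSobolevDerivs (n + 1) c d u D)
    (hode : ∀ᵐ x ∂(volume.restrict (Ioo c d)), D (n + 1) x = κ * D 0 x)
    (h0 : ∀ j ≤ n, D j c = 0) {j : ℕ} (hj : j ≤ n) : EqOn (D j) 0 (Icc c d) := by
  let y : ℝ → Fin (n + 1) → ℂ := fun t i => D i t
  let y' : ℝ → Fin (n + 1) → ℂ := fun t i => if (i : ℕ) = n then κ * D 0 t else D (i + 1) t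
  have hy' (t : ℝ) (ht : t ∈ Icc c d) : HasDerivWithinAt y (y' t) (Icc c d) t := by
    refine hasDerivWithinAt_pi.2 fun i => ?_
    by_cases hi : (i : ℕ) = n
    · simp only [y, y', hi, if_true]
      exact ((h.isPrimitiveOn hcd n.lt_succ_self).congr hcd.le (fun _ _ => rfl)
        hode).hasDerivWithinAt (continuousOn_const.mul (h.cont 0 n.succ_pos)) ht
    · simp only [y, y', hi, if_false]
      exact h.hasDerivWithinAt hcd (by omega) ht
  have hbound (t : ℝ) : ‖y' t‖ ≤ (1 + ‖κ‖) * ‖y t‖ := by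
    refine (pi_norm_le_iff_of_nonneg (by positivity)).2 fun i => ?_
    rw [one_add_mul]
    by_cases hi : (i : ℕ) = n
    · simp only [y', hi, if_true, norm_mul]
      exact le_add_of_nonneg_of_le (norm_nonneg _)
        (mul_le_mul_of_nonneg_left (norm_le_pi_norm (y t) 0) (norm_nonneg κ))
    · simp only [y', hi, if_false]
      exact le_add_of_le_of_nonneg (norm_le_pi_norm (y t) ⟨i + 1, by omega⟩) (by positivity)
  have hzero := eq_zero_of_abs_deriv_le_mul_abs_self_of_eq_zero_right
    (fun t ht => (hy' t ht).continuousWithinAt)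
    (fun t ht => (hy' t (Ico_subset_Icc_self ht)).mono_of_mem_nhdsWithin
      (mem_of_superset (Icc_mem_nhdsGE ht.2) (Icc_subset_Icc_left ht.1)))
    (funext fun i => h0 i (by omega)) (fun t _ => hbound t)
  exact fun t ht => congrFun (hzero t ht) ⟨j, by omega⟩

theorem IsSobolevDerivs.eqOn_of_ode (hcd : c < d) (hD : IsSobolevDerivs (n + 1) c d u D)
    (hE : IsSobolevDerivs (n + 1) c d w E)
    (hDode : ∀ᵐ x ∂(volume.restrict (Ioo c d)), D (n + 1) x = κ * D 0 x + g x)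
    (hEode : ∀ᵐ x ∂(volume.restrict (Ioo c d)), E (n + 1) x = κ * E 0 x + g x)
    (hc : ∀ j ≤ n, D j c = E j c) {j : ℕ} (hj : j ≤ n) : EqOn (D j) (E j) (Icc c d) := by
  have hode : ∀ᵐ x ∂(volume.restrict (Ioo c d)), (D - E) (n + 1) x = κ * (D - E) 0 x := by
    filter_upwards [hDode, hEode] with x hDx hEx
    simp only [Pi.sub_apply, hDx, hEx]
    ring
  exact fun x hx => sub_eq_zero.1 ((hD.sub hE).eqOn_zero_of_ode hcd hode
    (fun i hi => sub_eq_zero.2 (hc i hi)) hj hx)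

end InitialValueProblem

section Convolution

variable {k k' f : ℝ → ℂ}

theorem conv_zero (k f : ℝ → ℂ) : conv k f 0 = 0 :=
  intervalIntegral.integral_same

theorem conv_const_mul (c : ℂ) (k f : ℝ → ℂ) (x : ℝ) :
    conv (fun y => c * k y) f x = c * conv k f x := by
  simp only [conv, mul_assoc, intervalIntegral.integral_const_mul]

theorem conv_congr {x : ℝ} (hx : 0 ≤ x) (h : ∀ y, 0 ≤ y → k y = k' y) :
    conv k f x = conv k' f x := by
  refine intervalIntegral.integral_congr fun s hs => ?_
  rw [uIcc_of_le hx] at hs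
  simp only [h (x - s) (sub_nonneg.2 hs.2)]

theorem intervalIntegrable_indicator (hf : IntegrableOn f (Ioo 0 1)) (c d : ℝ) :
    IntervalIntegrable ((Icc (0 : ℝ) 1).indicator f) volume c d :=
  Integrable.intervalIntegrable
    ((integrable_indicator_iff measurableSet_Icc).2 ((integrableOn_Icc_iff_integrableOn_Ioo).2 hf))

theorem intervalIntegrable_conv (hk : Continuous k) (hf : IntegrableOn f (Ioo 0 1)) {d : ℝ}
    (hd : 0 ≤ d) : IntervalIntegrable (conv k f) volume 0 d :=
  intervalIntegrable_integral_triangle hd (integrable_uncurry_mul_of_continuous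
    (Φ := fun t s => k (t - s)) (hk.comp (continuous_fst.sub continuous_snd)) hd
    (intervalIntegrable_indicator hf 0 d))

theorem integral_conv_deriv (hk : ∀ x, HasDerivAt k (k' x) x) (hk' : Continuous k')
    (hf : IntegrableOn f (Ioo 0 1)) {x : ℝ} (hx : 0 ≤ x) :
    ∫ t in (0 : ℝ)..x, conv k' f t
      = ∫ s in (0 : ℝ)..x, (k (x - s) - k 0) * (Icc (0 : ℝ) 1).indicator f s := by
  have hint := integrable_uncurry_mul_of_continuous (Φ := fun t s => k' (t - s))
    (hk'.comp (continuous_fst.sub continuous_snd)) hx (intervalIntegrable_indicator hf 0 x)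
  refine (integral_triangle_swap hx hint).trans (intervalIntegral.integral_congr fun s _ => ?_)
  simp only [intervalIntegral.integral_mul_const]
  rw [intervalIntegral.integral_eq_sub_of_hasDerivAt (f := fun t => k (t - s))
    (fun t _ => (hk (t - s)).comp_sub_const t s)
    ((hk'.comp (continuous_id.sub continuous_const)).intervalIntegrable s x), sub_self]

theorem isPrimitiveOn_conv (hk : ∀ x, HasDerivAt k (k' x) x) (hk' : Continuous k')
    (hf : IntegrableOn f (Ioo 0 1)) {d : ℝ} (hd : 0 ≤ d) :
    IsPrimitiveOn 0 d (conv k f) fun t => conv k' f t + k 0 * (Icc (0 : ℝ) 1).indicator f t where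
  intervalIntegrable :=
    (intervalIntegrable_conv hk' hf hd).add ((intervalIntegrable_indicator hf 0 d).const_mul (k 0))
  eq_add_integral x hx := by
    have hkc : Continuous k := continuous_iff_continuousAt.2 fun y => (hk y).continuousAt
    have hfi := intervalIntegrable_indicator hf 0 x
    rw [conv_zero, zero_add, intervalIntegral.integral_add (intervalIntegrable_conv hk' hf hx.1)
      (hfi.const_mul (k 0)), integral_conv_deriv hk hk' hf hx.1,
      ← intervalIntegral.integral_add _ (hfi.const_mul (k 0))]
    · exact intervalIntegral.integral_congr fun s _ => by ring
    · exact hfi.continuousOn_mul (Continuous.continuousOn (by fun_prop))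

end Convolution

/-- `k 0, k 1, …` are the successive derivatives of `c` times the fundamental solution of
`y⁽ⁿ⁺¹⁾ = κ y`, that is, of the solution with `y = y' = ⋯ = y⁽ⁿ⁻¹⁾ = 0` and `y⁽ⁿ⁾ = c` at `0`. -/
structure IsGreenFamily (n : ℕ) (c κ : ℂ) (k : ℕ → ℝ → ℂ) : Prop where
  hasDerivAt : ∀ j x, HasDerivAt (k j) (k (j + 1) x) x
  zero : ∀ j < n, k j 0 = 0
  top : k n 0 = c
  periodic : ∀ j x, k (j + (n + 1)) x = κ * k j x

/-- The derivatives of order `j ≤ n + 1` of the convolution of `k 0` and `f` on `[0, 1]`, when `k`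
is a Green family of order `n + 1` with constant `c`. -/
def duhamel (n : ℕ) (c : ℂ) (k : ℕ → ℝ → ℂ) (f : ℝ → ℂ) (j : ℕ) (x : ℝ) : ℂ :=
  conv (k j) f x + if j = n + 1 then c * f x else 0

theorem duhamel_of_le {n : ℕ} (c : ℂ) (k : ℕ → ℝ → ℂ) (f : ℝ → ℂ) {j : ℕ} (hj : j ≤ n) :
    duhamel n c k f j = conv (k j) f :=
  funext fun x => by rw [duhamel, if_neg (by omega), add_zero]

theorem hasDerivAt_mul_heaviside {k k' : ℝ → ℂ} (hk : ∀ x, HasDerivAt k (k' x) x) (h0 : k 0 = 0)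
    (h0' : k' 0 = 0) (x : ℝ) :
    HasDerivAt (fun x => k x * heaviside x) (k' x * heaviside x) x := by
  rcases lt_trichotomy x 0 with hx | rfl | hx
  · have hzero : (fun x => k x * heaviside x) =ᶠ[𝓝 x] fun _ => 0 := by
      filter_upwards [Iio_mem_nhds hx] with y hy
      rw [heaviside, if_neg (not_le.2 hy), mul_zero]
    rw [heaviside, if_neg (not_le.2 hx), mul_zero]
    exact (hasDerivAt_const x (0 : ℂ)).congr_of_eventuallyEq hzero
  · have hk0 := hk 0
    rw [h0', hasDerivAt_iff_isLittleO] at hk0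
    rw [h0', zero_mul, hasDerivAt_iff_isLittleO]
    refine (Asymptotics.IsBigO.of_bound 1 (Eventually.of_forall fun y => ?_)).trans_isLittleO hk0
    simp only [h0, smul_zero, sub_zero, zero_mul, one_mul, heaviside]
    split_ifs <;> simp
  · have hself : (fun x => k x * heaviside x) =ᶠ[𝓝 x] k := by
      filter_upwards [Ioi_mem_nhds hx] with y hy
      rw [heaviside, if_pos (le_of_lt hy), mul_one]
    rw [heaviside, if_pos hx.le, mul_one]
    exact (hk x).congr_of_eventuallyEq hself

namespace IsGreenFamily

variable {n : ℕ} {c κ : ℂ} {k : ℕ → ℝ → ℂ} {f : ℝ → ℂ}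

theorem continuous (h : IsGreenFamily n c κ k) (j : ℕ) : Continuous (k j) :=
  continuous_iff_continuousAt.2 fun x => (h.hasDerivAt j x).continuousAt

theorem isPrimitiveOn_conv (h : IsGreenFamily n c κ k) (hf : IntegrableOn f (Ioo 0 1)) {j : ℕ}
    (hj : j < n) {d : ℝ} (hd : 0 ≤ d) :
    IsPrimitiveOn 0 d (conv (k j) f) (conv (k (j + 1)) f) := by
  simpa only [h.zero j hj, zero_mul, add_zero] using
    Beam.isPrimitiveOn_conv (h.hasDerivAt j) (h.continuous (j + 1)) hf hd

theorem continuousOn_conv (h : IsGreenFamily n c κ k) (hf : IntegrableOn f (Ioo 0 1)) (j : ℕ)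
    {d : ℝ} (hd : 0 ≤ d) : ContinuousOn (conv (k j) f) (Icc 0 d) :=
  (Beam.isPrimitiveOn_conv (h.hasDerivAt j) (h.continuous (j + 1)) hf hd).continuousOn

theorem hasDerivAt_conv (h : IsGreenFamily n c κ k) (hf : IntegrableOn f (Ioo 0 1)) {j : ℕ}
    (hj : j < n) {x : ℝ} (hx : 0 < x) :
    HasDerivAt (conv (k j) f) (conv (k (j + 1)) f x) x := by
  have hd : 0 ≤ x + 1 := by positivity
  exact ((h.isPrimitiveOn_conv hf hj hd).hasDerivWithinAt (h.continuousOn_conv hf (j + 1) hd)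
    ⟨hx.le, (lt_add_one x).le⟩).hasDerivAt (Icc_mem_nhds hx (lt_add_one x))

theorem iteratedDeriv_two_conv_mul_heaviside (h : IsGreenFamily n c κ k) (hn : 2 ≤ n)
    (hf : IntegrableOn f (Ioo 0 1)) {x : ℝ} (hx : 0 < x) :
    iteratedDeriv 2 (conv (fun y => k 0 y * heaviside y) f) x = conv (k 2) f x := by
  have hconv : conv (fun y => k 0 y * heaviside y) f =ᶠ[𝓝 x] conv (k 0) f := by
    filter_upwards [Ioi_mem_nhds hx] with y hy
    exact conv_congr (le_of_lt hy) fun z hz => by rw [heaviside, if_pos hz, mul_one]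
  have hderiv : deriv (conv (k 0) f) =ᶠ[𝓝 x] conv (k 1) f := by
    filter_upwards [Ioi_mem_nhds hx] with y hy
    exact (h.hasDerivAt_conv hf (by omega) hy).deriv
  rw [hconv.iteratedDeriv_eq, iteratedDeriv_succ, iteratedDeriv_one, hderiv.deriv_eq]
  exact (h.hasDerivAt_conv hf hn hx).deriv

theorem iteratedDeriv_two_mul_heaviside (h : IsGreenFamily n c κ k) (hn : 2 < n) (x : ℝ) :
    iteratedDeriv 2 (fun y => k 0 y * heaviside y) x = k 2 x * heaviside x := by
  have hderiv (j : ℕ) (hj : j + 1 < n) : deriv (fun y => k j y * heaviside y)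
      = fun y => k (j + 1) y * heaviside y := funext fun y =>
    (hasDerivAt_mul_heaviside (h.hasDerivAt j) (h.zero j (by omega)) (h.zero _ hj) y).deriv
  rw [iteratedDeriv_succ, iteratedDeriv_one, hderiv 0 (by omega), hderiv 1 hn]

theorem isSobolevDerivs_duhamel (h : IsGreenFamily n c κ k) (hf : MemL2 0 1 f) :
    IsSobolevDerivs (n + 1) 0 1 (conv (k 0) f) (duhamel n c k f) := by
  have htop : MemL2 0 1 (fun x => duhamel n c k f (n + 1) x) := by
    simp only [duhamel, ↓reduceIte]
    exact (memL2_of_continuousOn (h.continuousOn_conv hf.integrableOn (n + 1)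
      zero_le_one)).add (MemLp.const_mul hf c)
  rw [← duhamel_of_le c k f n.zero_le]
  refine IsSobolevDerivs.of_isPrimitiveOn zero_le_one htop fun j hj => ?_
  rw [duhamel_of_le c k f (Nat.le_of_lt_succ hj)]
  rcases (Nat.le_of_lt_succ hj).lt_or_eq with hjn | rfl
  · rw [duhamel_of_le c k f hjn]
    exact h.isPrimitiveOn_conv hf.integrableOn hjn zero_le_one
  · refine (Beam.isPrimitiveOn_conv (h.hasDerivAt j) (h.continuous (j + 1)) hf.integrableOn
      zero_le_one).congr zero_le_one (fun _ _ => rfl) ?_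
    filter_upwards [ae_restrict_mem measurableSet_Ioo] with x hx
    rw [indicator_of_mem (Ioo_subset_Icc_self hx), h.top, duhamel, if_pos rfl]

theorem duhamel_succ (h : IsGreenFamily n c κ k) (f : ℝ → ℂ) (x : ℝ) :
    duhamel n c k f (n + 1) x = κ * duhamel n c k f 0 x + c * f x := by
  have hk : k (n + 1) = fun y => κ * k 0 y := funext fun y => by simpa using h.periodic 0 y
  rw [duhamel, if_pos rfl, duhamel_of_le c k f n.zero_le, hk, conv_const_mul]

end IsGreenFamily

/-- The derivatives of `(sinh (λ x) - sin (λ x)) / (2 a λ³)`. -/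
def kernel (a : ℝ) (lam : ℂ) : ℕ → ℝ → ℂ
  | 0 => fun x => 1 / (2 * a * lam ^ 3) * (Complex.sinh (lam * x) - Complex.sin (lam * x))
  | 1 => fun x => 1 / (2 * a * lam ^ 2) * (Complex.cosh (lam * x) - Complex.cos (lam * x))
  | 2 => fun x => 1 / (2 * a * lam) * (Complex.sinh (lam * x) + Complex.sin (lam * x))
  | 3 => fun x => 1 / (2 * a) * (Complex.cosh (lam * x) + Complex.cos (lam * x))
  | n + 4 => fun x => lam ^ 4 * kernel a lam n x

section Kernel

variable {a : ℝ} {lam : ℂ}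

theorem hasDerivAt_kernel (a : ℝ) (hlam : lam ≠ 0) (n : ℕ) (x : ℝ) :
    HasDerivAt (kernel a lam n) (kernel a lam (n + 1) x) x := by
  have hx : HasDerivAt (fun z : ℂ => lam * z) lam x := by
    simpa using (hasDerivAt_id (x : ℂ)).const_mul lam
  induction n using kernel.induct with
  | case1 =>
    refine ((hx.csinh.sub hx.csin).const_mul (1 / (2 * a * lam ^ 3) : ℂ)).comp_ofReal.congr_deriv ?_
    simp only [kernel]
    field_simp
  | case2 =>
    refine ((hx.ccosh.sub hx.ccos).const_mul (1 / (2 * a * lam ^ 2) : ℂ)).comp_ofReal.congr_deriv ?_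
    simp only [kernel]
    field_simp
    ring
  | case3 =>
    refine ((hx.csinh.add hx.csin).const_mul (1 / (2 * a * lam) : ℂ)).comp_ofReal.congr_deriv ?_
    simp only [kernel]
    field_simp
  | case4 =>
    refine ((hx.ccosh.add hx.ccos).const_mul (1 / (2 * a) : ℂ)).comp_ofReal.congr_deriv ?_
    simp only [kernel]
    field_simp
    ring
  | case5 n ih => exact ih.const_mul (lam ^ 4)

theorem isGreenFamily_kernel (a : ℝ) (hlam : lam ≠ 0) :
    IsGreenFamily 3 (1 / a) (lam ^ 4) (kernel a lam) where
  hasDerivAt := hasDerivAt_kernel a hlam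
  zero j hj := by interval_cases j <;> simp [kernel]
  top := by
    simp only [kernel, Complex.ofReal_zero, mul_zero, Complex.cosh_zero, Complex.cos_zero]
    ring
  periodic _ _ := rfl

theorem u0_of_nonneg (a : ℝ) (lam : ℂ) {x : ℝ} (hx : 0 ≤ x) : u0 a lam x = kernel a lam 0 x := by
  rw [u0, heaviside, if_pos hx, mul_one, kernel]

theorem u0xx_of_nonneg (a : ℝ) (hlam : lam ≠ 0) {x : ℝ} (hx : 0 ≤ x) :
    u0xx a lam x = kernel a lam 2 x := by
  rw [show u0xx a lam x = kernel a lam 2 x * heaviside x from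
    (isGreenFamily_kernel a hlam).iteratedDeriv_two_mul_heaviside (by norm_num) x,
    heaviside, if_pos hx, mul_one]

theorem conv_u0 (a : ℝ) (lam : ℂ) (f : ℝ → ℂ) {x : ℝ} (hx : 0 ≤ x) :
    conv (u0 a lam) f x = conv (kernel a lam 0) f x :=
  conv_congr hx fun _ => u0_of_nonneg a lam

theorem iteratedDeriv_two_conv_u0 (a : ℝ) (hlam : lam ≠ 0) {f : ℝ → ℂ}
    (hf : IntegrableOn f (Ioo 0 1)) {x : ℝ} (hx : 0 < x) :
    iteratedDeriv 2 (conv (u0 a lam) f) x = conv (kernel a lam 2) f x :=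
  (isGreenFamily_kernel a hlam).iteratedDeriv_two_conv_mul_heaviside (by norm_num) hf hx

theorem kernel_two_add_kernel_zero (a : ℝ) (hlam : lam ≠ 0) (x : ℝ) :
    kernel a lam 2 x + lam ^ 2 * kernel a lam 0 x = Complex.sinh (lam * x) / (a * lam) := by
  simp only [kernel]
  field_simp
  ring

theorem kernel_two_sub_kernel_zero (a : ℝ) (hlam : lam ≠ 0) (x : ℝ) :
    kernel a lam 2 x - lam ^ 2 * kernel a lam 0 x = Complex.sin (lam * x) / (a * lam) := by
  simp only [kernel]
  field_simp
  ring

end Kernel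

/-- `u`, whose `j`-th derivatives on `(0, ξ)` and `(ξ, 1)` are `l j` and `r j`, satisfies
`u⁗ = κ u + g` on both intervals and `u = u'' = 0` at `0` and `1`; at `ξ` it is twice continuously
differentiable and its third derivative jumps by `J`. -/
structure IsTransmissionSolution (ξ : ℝ) (κ J : ℂ) (g u : ℝ → ℂ) (l r : ℕ → ℝ → ℂ) : Prop where
  sobolev_left : IsSobolevDerivs 4 0 ξ u l
  sobolev_right : IsSobolevDerivs 4 ξ 1 u r
  ode_left : ∀ᵐ x ∂(volume.restrict (Ioo 0 ξ)), l 4 x = κ * l 0 x + g x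
  ode_right : ∀ᵐ x ∂(volume.restrict (Ioo ξ 1)), r 4 x = κ * r 0 x + g x
  left_zero : l 0 0 = 0
  left_two : l 2 0 = 0
  right_zero : r 0 1 = 0
  right_two : r 2 1 = 0
  pieces_eq : ∀ j < 3, l j ξ = r j ξ
  jump : r 3 ξ - l 3 ξ = J

section Weak

variable {a b α ξ : ℝ} {κ J μ : ℂ} {f g u v w z u₁ v₁ : ℝ → ℂ} {l r : ℕ → ℝ → ℂ}

theorem MemSobolev.continuousOn {m : ℕ} {c d : ℝ} (h : MemSobolev m c d f) (hm : 0 < m) :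
    ContinuousOn f (Icc c d) :=
  h.elim fun _ hD => (hD.cont 0 hm).congr fun x hx => (hD.zero x hx).symm

theorem memL2_f10 (b : ℝ) (μ : ℂ) (h : InEnergySpace u₁ v₁) : MemL2 0 1 (f10 b μ u₁ v₁) :=
  MemLp.add (memL2_of_continuousOn (continuousOn_const.mul (h.sobolev.continuousOn two_pos)))
    h.memL2

theorem OperatorMapsTo.ae_eq_of_notMem (h : OperatorMapsTo a b α ξ u v w z) {p q : ℝ} (hp : 0 ≤ p)
    (hq : q ≤ 1) (hξ : ξ ∉ Ioo p q) {D : ℕ → ℝ → ℂ} (hD : IsSobolevDerivs 4 p q u D) :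
    ∀ᵐ x ∂(volume.restrict (Ioo p q)), z x + a * D 4 x + b * v x = 0 := by
  have hz := (h.memL2.mono hp hq).integrableOn
  have hv := (h.domain.energy.memL2.mono hp hq).integrableOn
  have hD4 := (hD.memL2 4 le_rfl).integrableOn
  refine ae_eq_zero_of_forall_isTestFunction ((hz.add (hD4.const_mul a)).add (hv.const_mul b))
    fun φ hφ => ?_
  have hweak := h.snd φ (hφ.mono hp hq)
  rw [hφ.eq_zero hξ, hφ.integral_Ioo_mul hp hq, hφ.integral_Ioo_mul hp hq,
    (hφ.iteratedDeriv 4).integral_Ioo_mul hp hq, hD.integral_mul_iteratedDeriv hφ] at hweak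
  have hzφ := hφ.integrableOn_mul hz
  have hDφ := (hφ.integrableOn_mul hD4).const_mul (a : ℂ)
  have hvφ := (hφ.integrableOn_mul hv).const_mul (b : ℂ)
  have hsum : IntegrableOn (fun x => z x * φ x + a * (D 4 x * φ x)) (Ioo p q) := hzφ.add hDφ
  simp only [add_mul, mul_assoc]
  rw [integral_add hsum hvφ, integral_add hzφ hDφ, integral_const_mul, integral_const_mul, hweak]
  ring

theorem SolvesResolvent.snd_eq (h : SolvesResolvent a b α ξ μ u₁ v₁ u v) {x : ℝ}
    (hx : x ∈ Icc (0 : ℝ) 1) : v x = μ * u x - u₁ x := by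
  obtain ⟨w, z, hop, hfst, -⟩ := h
  rw [← hfst x hx, hop.fst x hx, sub_sub_cancel]

theorem SolvesResolvent.ode (ha : a ≠ 0) (h : SolvesResolvent a b α ξ μ u₁ v₁ u v) {p q : ℝ}
    (hp : 0 ≤ p) (hq : q ≤ 1) (hξ : ξ ∉ Ioo p q) {D : ℕ → ℝ → ℂ}
    (hD : IsSobolevDerivs 4 p q u D) :
    ∀ᵐ x ∂(volume.restrict (Ioo p q)),
      D 4 x = -(b * μ + μ ^ 2) / a * D 0 x + 1 / a * f10 b μ u₁ v₁ x := by
  have hv {x : ℝ} := h.snd_eq (x := x)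
  obtain ⟨w, z, hop, -, hz⟩ := h
  have hsub : Ioo p q ⊆ Ioo 0 1 := Ioo_subset_Ioo hp hq
  filter_upwards [hop.ae_eq_of_notMem hp hq hξ hD, ae_mono (Measure.restrict_mono hsub le_rfl) hz,
    ae_restrict_mem measurableSet_Ioo] with x hDx hzx hx
  have ha' : (a : ℂ) ≠ 0 := Complex.ofReal_ne_zero.2 ha
  rw [hv (Ioo_subset_Icc_self (hsub hx))] at hDx hzx
  rw [hD.zero x (Ioo_subset_Icc_self hx), f10]
  field_simp
  linear_combination hDx + hzx

theorem SolvesResolvent.exists_isTransmissionSolution (ha : a ≠ 0) (hξ : ξ ∈ Ioo (0 : ℝ) 1)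
    (h : SolvesResolvent a b α ξ μ u₁ v₁ u v) :
    ∃ l r, IsTransmissionSolution ξ (-(b * μ + μ ^ 2) / a) (α * (u₁ ξ - μ * u ξ) * (1 / a))
      (fun x => 1 / a * f10 b μ u₁ v₁ x) u l r := by
  have hvξ := h.snd_eq (Ioo_subset_Icc_self hξ)
  have hode {p q : ℝ} := h.ode ha (p := p) (q := q)
  obtain ⟨w, z, hop, -, -⟩ := h
  obtain ⟨l, r, hl, hr, hl2, hr2, hlr2, hjump⟩ := hop.domain.pieces
  obtain ⟨D, hD⟩ := hop.domain.energy.sobolev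
  have hpieces (j : ℕ) (hj : j < 2) : l j ξ = r j ξ :=
    hD.pieces_eq (hl.mono_order (by norm_num)) (hr.mono_order (by norm_num)) hξ.1 hξ.2 hj
  refine ⟨l, r, hl, hr, hode le_rfl hξ.2.le (fun h => lt_irrefl ξ h.2) hl, ?_, ?_, hl2, ?_, hr2,
    ?_, ?_⟩
  · exact hode hξ.1.le le_rfl (fun h => lt_irrefl ξ h.1) hr
  · exact (hl.zero 0 (left_mem_Icc.2 hξ.1.le)).trans hop.domain.energy.left
  · exact (hr.zero 1 (right_mem_Icc.2 hξ.2.le)).trans hop.domain.energy.right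
  · exact fun j hj => (Nat.le_of_lt_succ hj).lt_or_eq.elim (hpieces j) fun hj => hj ▸ hlr2
  · rw [hjump, hvξ]
    ring

namespace IsTransmissionSolution

theorem integral_mul_iteratedDeriv_four (h : IsTransmissionSolution ξ κ J g u l r)
    (hξ : ξ ∈ Ioo (0 : ℝ) 1) {φ : ℝ → ℂ} (hφ : IsTestFunction 0 1 φ) :
    ∫ x in Ioo 0 1, u x * iteratedDeriv 4 φ x
      = J * φ ξ + ∫ x in Ioo 0 1, (κ * u x + g x) * φ x := by
  have hl : l 4 =ᵐ[volume.restrict (Ioo 0 ξ)] fun x => κ * u x + g x := by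
    filter_upwards [h.ode_left, ae_restrict_mem measurableSet_Ioo] with x hode hx
    rw [hode, h.sobolev_left.zero x (Ioo_subset_Icc_self hx)]
  have hr : r 4 =ᵐ[volume.restrict (Ioo ξ 1)] fun x => κ * u x + g x := by
    filter_upwards [h.ode_right, ae_restrict_mem measurableSet_Ioo] with x hode hx
    rw [hode, h.sobolev_right.zero x (Ioo_subset_Icc_self hx)]
  have hlφ : ∫ x in Ioo 0 ξ, l 4 x * φ x = ∫ x in Ioo 0 ξ, (κ * u x + g x) * φ x :=
    integral_congr_ae (hl.mul (ae_eq_refl φ))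
  have hrφ : ∫ x in Ioo ξ 1, r 4 x * φ x = ∫ x in Ioo ξ 1, (κ * u x + g x) * φ x :=
    integral_congr_ae (hr.mul (ae_eq_refl φ))
  rw [integral_mul_iteratedDeriv_of_pieces_jump h.sobolev_left h.sobolev_right hξ.1 hξ.2 hφ
      h.pieces_eq, setIntegral_Ioo_add_adjacent hξ.1.le hξ.2.le
      (hφ.integrableOn_mul ((h.sobolev_left.memL2 4 le_rfl).integrableOn.congr hl))
      (hφ.integrableOn_mul ((h.sobolev_right.memL2 4 le_rfl).integrableOn.congr hr)),
    hlφ, hrφ, ← h.jump]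
  ring

theorem inDomain (h : IsTransmissionSolution ξ κ (α * (u₁ ξ - μ * u ξ) * (1 / a)) g u l r)
    (hξ : ξ ∈ Ioo (0 : ℝ) 1) (hF : InEnergySpace u₁ v₁) :
    InDomain a α ξ u fun x => μ * u x - u₁ x := by
  have hu : MemSobolev 2 0 1 u := memSobolev_of_pieces (h.sobolev_left.mono_order (by norm_num))
    (h.sobolev_right.mono_order (by norm_num)) hξ.1 hξ.2 fun j hj => h.pieces_eq j (by omega)
  have hv : MemSobolev 2 0 1 fun x => μ * u x - u₁ x := by
    obtain ⟨D, hD⟩ := hu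
    obtain ⟨D₁, hD₁⟩ := hF.sobolev
    exact ⟨_, (hD.const_smul μ).sub hD₁⟩
  have hu0 : u 0 = 0 :=
    (h.sobolev_left.zero 0 (left_mem_Icc.2 hξ.1.le)).symm.trans h.left_zero
  have hu1 : u 1 = 0 :=
    (h.sobolev_right.zero 1 (right_mem_Icc.2 hξ.2.le)).symm.trans h.right_zero
  refine ⟨⟨hu, hu0, hu1, memL2_of_continuousOn (hv.continuousOn two_pos)⟩, hv, ?_, ?_, l, r,
    h.sobolev_left, h.sobolev_right, h.left_two, h.right_two, h.pieces_eq 2 (by norm_num), ?_⟩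
  · rw [hu0, hF.left, mul_zero, sub_zero]
  · rw [hu1, hF.right, mul_zero, sub_zero]
  · rw [h.jump]
    ring

theorem solvesResolvent (ha : a ≠ 0) (hξ : ξ ∈ Ioo (0 : ℝ) 1) (hF : InEnergySpace u₁ v₁)
    (h : IsTransmissionSolution ξ (-(b * μ + μ ^ 2) / a) (α * (u₁ ξ - μ * u ξ) * (1 / a))
      (fun x => 1 / a * f10 b μ u₁ v₁ x) u l r) :
    SolvesResolvent a b α ξ μ u₁ v₁ u fun x => μ * u x - u₁ x := by
  have ha' : (a : ℂ) ≠ 0 := Complex.ofReal_ne_zero.2 ha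
  set v : ℝ → ℂ := fun x => μ * u x - u₁ x with hv
  have hdom : InDomain a α ξ u v := h.inDomain hξ hF
  have hz : MemL2 0 1 fun x => μ * v x - v₁ x :=
    (MemLp.const_mul hdom.energy.memL2 μ).sub hF.memL2
  refine ⟨v, fun x => μ * v x - v₁ x, ⟨hdom, fun _ _ => rfl, hz, fun φ hφ => ?_⟩,
    fun x _ => sub_sub_cancel _ _, ae_of_all _ fun x => sub_sub_cancel _ _⟩
  have hode : ∫ x in Ioo (0 : ℝ) 1,
      (-(b * μ + μ ^ 2) / a * u x + 1 / a * f10 b μ u₁ v₁ x) * φ x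
      = -(1 / a) * ((∫ x in Ioo (0 : ℝ) 1, (μ * v x - v₁ x) * φ x)
        + b * ∫ x in Ioo (0 : ℝ) 1, v x * φ x) := by
    rw [← integral_const_mul, ← integral_add (hφ.integrableOn_mul hz.integrableOn)
      ((hφ.integrableOn_mul hdom.energy.memL2.integrableOn).const_mul _), ← integral_const_mul]
    congr 1 with x
    simp only [hv, f10]
    ring
  rw [h.integral_mul_iteratedDeriv_four hξ hφ, hode]
  field_simp
  simp only [hv]
  ring

end IsTransmissionSolution

end Weak

section Shooting

/-- The derivatives of the solution of `y⁗ = κ y + c f` with `y = y'' = 0`, `y' = c q` and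
`y''' = c p` at `0`, when `k` is a Green family of order `4` with constants `c` and `κ`. -/
def initialValueFamily (c : ℂ) (k : ℕ → ℝ → ℂ) (f : ℝ → ℂ) (p q : ℂ) : ℕ → ℝ → ℂ :=
  duhamel 3 c k f + p • k + q • fun j => k (j + 2)

/-- The continuation to `[ξ, 1]` of the solution with derivatives `initialValueFamily c k f p q`,
the third derivative of which jumps by `s c` at `ξ`. -/
def continuedFamily (c : ℂ) (k : ℕ → ℝ → ℂ) (f : ℝ → ℂ) (p q s : ℂ) (ξ : ℝ) : ℕ → ℝ → ℂ :=
  initialValueFamily c k f p q + s • fun j x => k j (x - ξ)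

/-- The solution of `u⁗ = κ u + c f` on `(0, ξ)` and `(ξ, 1)` with `u = u'' = 0`, `u' = c q` and
`u''' = c p` at `0`, the third derivative of which jumps by `s c` at `ξ`. -/
def forcedSolution (c : ℂ) (k : ℕ → ℝ → ℂ) (f : ℝ → ℂ) (p q s : ℂ) (ξ x : ℝ) : ℂ :=
  initialValueFamily c k f p q 0 x + s * (k 0 (x - ξ) * heaviside (x - ξ))

theorem initialValueFamily_apply (c : ℂ) (k : ℕ → ℝ → ℂ) (f : ℝ → ℂ) (p q : ℂ) {j : ℕ} (hj : j ≤ 3)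
    (x : ℝ) : initialValueFamily c k f p q j x = conv (k j) f x + p * k j x + q * k (j + 2) x := by
  rw [← duhamel_of_le c k f hj]
  rfl

theorem forcedSolution_eqOn_right (c : ℂ) (k : ℕ → ℝ → ℂ) (f : ℝ → ℂ) (p q s : ℂ) (ξ : ℝ) :
    EqOn (forcedSolution c k f p q s ξ) (continuedFamily c k f p q s ξ 0) (Ici ξ) := fun x hx => by
  rw [forcedSolution, heaviside, if_pos (sub_nonneg.2 hx), mul_one]
  rfl

variable {ξ : ℝ} {c κ p q s : ℂ} {k l r : ℕ → ℝ → ℂ} {f u : ℝ → ℂ}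

namespace IsGreenFamily

theorem isSobolevDerivs_initialValueFamily (hk : IsGreenFamily 3 c κ k) (hf : MemL2 0 1 f)
    (p q : ℂ) : IsSobolevDerivs 4 0 1 (initialValueFamily c k f p q 0)
      (initialValueFamily c k f p q) := by
  rw [initialValueFamily, Pi.add_apply, Pi.add_apply, duhamel_of_le c k f (Nat.zero_le 3)]
  exact ((hk.isSobolevDerivs_duhamel hf).add
    ((IsSobolevDerivs.of_hasDerivAt hk.hasDerivAt 4 zero_le_one).const_smul p)).add
    ((IsSobolevDerivs.of_hasDerivAt (fun j => hk.hasDerivAt (j + 2)) 4 zero_le_one).const_smul q)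

theorem isSobolevDerivs_continuedFamily (hk : IsGreenFamily 3 c κ k) (hf : MemL2 0 1 f)
    (hξ : ξ ∈ Icc (0 : ℝ) 1) (p q s : ℂ) : IsSobolevDerivs 4 ξ 1 (continuedFamily c k f p q s ξ 0)
      (continuedFamily c k f p q s ξ) :=
  ((hk.isSobolevDerivs_initialValueFamily hf p q).mono hξ.1 le_rfl).add
    ((IsSobolevDerivs.of_hasDerivAt (fun j x => (hk.hasDerivAt j (x - ξ)).comp_sub_const x ξ)
      4 hξ.2).const_smul s)

theorem initialValueFamily_four (hk : IsGreenFamily 3 c κ k) (f : ℝ → ℂ) (p q : ℂ) (x : ℝ) :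
    initialValueFamily c k f p q 4 x = κ * initialValueFamily c k f p q 0 x + c * f x := by
  simp only [initialValueFamily, Pi.add_apply, Pi.smul_apply, smul_eq_mul, hk.duhamel_succ f x]
  linear_combination p * hk.periodic 0 x + q * hk.periodic 2 x

theorem continuedFamily_four (hk : IsGreenFamily 3 c κ k) (f : ℝ → ℂ) (p q s : ℂ) (ξ x : ℝ) :
    continuedFamily c k f p q s ξ 4 x = κ * continuedFamily c k f p q s ξ 0 x + c * f x := by
  simp only [continuedFamily, Pi.add_apply, Pi.smul_apply, smul_eq_mul,
    hk.initialValueFamily_four f p q x]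
  linear_combination s * hk.periodic 0 (x - ξ)

theorem initialValueFamily_apply_zero (hk : IsGreenFamily 3 c κ k) (f : ℝ → ℂ) (p q : ℂ)
    (j : Fin 4) : initialValueFamily c k f p q j 0 = ![0, q * c, 0, p * c] j := by
  have h4 : k 4 0 = 0 := by rw [hk.periodic 0 0, hk.zero 0 three_pos, mul_zero]
  have h5 : k 5 0 = 0 := by rw [hk.periodic 1 0, hk.zero 1 (by norm_num), mul_zero]
  rw [initialValueFamily_apply c k f p q (Nat.le_of_lt_succ j.is_lt), conv_zero]
  fin_cases j <;> simp [hk.zero, hk.top, h4, h5]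

theorem continuedFamily_apply_of_lt (hk : IsGreenFamily 3 c κ k) (f : ℝ → ℂ) (p q s : ℂ) (ξ : ℝ)
    {j : ℕ} (hj : j < 3) :
    continuedFamily c k f p q s ξ j ξ = initialValueFamily c k f p q j ξ := by
  simp [continuedFamily, hk.zero j hj]

theorem continuedFamily_three_sub (hk : IsGreenFamily 3 c κ k) (f : ℝ → ℂ) (p q s : ℂ) (ξ : ℝ) :
    continuedFamily c k f p q s ξ 3 ξ - initialValueFamily c k f p q 3 ξ = s * c := by
  simp [continuedFamily, hk.top]

theorem forcedSolution_eqOn_left (hk : IsGreenFamily 3 c κ k) (f : ℝ → ℂ) (p q s : ℂ) (ξ : ℝ) :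
    EqOn (forcedSolution c k f p q s ξ) (initialValueFamily c k f p q 0) (Iic ξ) := fun x hx => by
  rcases (mem_Iic.1 hx).lt_or_eq with hx | rfl
  · rw [forcedSolution, heaviside, if_neg (by linarith), mul_zero, mul_zero, add_zero]
  · rw [forcedSolution, sub_self, hk.zero 0 three_pos, zero_mul, mul_zero, add_zero]

theorem isTransmissionSolution_forcedSolution (hk : IsGreenFamily 3 c κ k) (hf : MemL2 0 1 f)
    (hξ : ξ ∈ Ioo (0 : ℝ) 1) (h0 : continuedFamily c k f p q s ξ 0 1 = 0)
    (h2 : continuedFamily c k f p q s ξ 2 1 = 0) :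
    IsTransmissionSolution ξ κ (s * c) (fun x => c * f x) (forcedSolution c k f p q s ξ)
      (initialValueFamily c k f p q) (continuedFamily c k f p q s ξ) where
  sobolev_left := ((hk.isSobolevDerivs_initialValueFamily hf p q).mono le_rfl hξ.2.le).congr
    fun _ hx => (hk.forcedSolution_eqOn_left f p q s ξ hx.2).symm
  sobolev_right := (hk.isSobolevDerivs_continuedFamily hf (Ioo_subset_Icc_self hξ) p q s).congr
    fun _ hx => (forcedSolution_eqOn_right c k f p q s ξ hx.1).symm
  ode_left := ae_of_all _ (hk.initialValueFamily_four f p q)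
  ode_right := ae_of_all _ (hk.continuedFamily_four f p q s ξ)
  left_zero := hk.initialValueFamily_apply_zero f p q 0
  left_two := hk.initialValueFamily_apply_zero f p q 2
  right_zero := h0
  right_two := h2
  pieces_eq _ hj := (hk.continuedFamily_apply_of_lt f p q s ξ hj).symm
  jump := hk.continuedFamily_three_sub f p q s ξ

end IsGreenFamily

theorem IsTransmissionSolution.exists_eqOn_forcedSolution
    (h : IsTransmissionSolution ξ κ (s * c) (fun x => c * f x) u l r)
    (hk : IsGreenFamily 3 c κ k) (hc : c ≠ 0) (hf : MemL2 0 1 f) (hξ : ξ ∈ Ioo (0 : ℝ) 1) :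
    ∃ p q, EqOn u (forcedSolution c k f p q s ξ) (Icc 0 1) ∧
      continuedFamily c k f p q s ξ 0 1 = 0 ∧ continuedFamily c k f p q s ξ 2 1 = 0 := by
  set p := l 3 0 / c with hp
  set q := l 1 0 / c with hq
  have hl0 (j : ℕ) (hj : j ≤ 3) : l j 0 = initialValueFamily c k f p q j 0 := by
    rw [hk.initialValueFamily_apply_zero f p q ⟨j, Nat.lt_succ_of_le hj⟩]
    interval_cases j <;> simp [h.left_zero, h.left_two, hp, hq, hc]
  have hl {j : ℕ} (hj : j ≤ 3) : EqOn (l j) (initialValueFamily c k f p q j) (Icc 0 ξ) :=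
    h.sobolev_left.eqOn_of_ode hξ.1
      ((hk.isSobolevDerivs_initialValueFamily hf p q).mono le_rfl hξ.2.le) h.ode_left
      (ae_of_all _ (hk.initialValueFamily_four f p q)) hl0 hj
  have hlξ {j : ℕ} (hj : j ≤ 3) := hl hj (right_mem_Icc.2 hξ.1.le)
  have hrξ (j : ℕ) (hj : j ≤ 3) : r j ξ = continuedFamily c k f p q s ξ j ξ := by
    rcases hj.lt_or_eq with hj | rfl
    · rw [hk.continuedFamily_apply_of_lt f p q s ξ hj, ← hlξ hj.le, h.pieces_eq j hj]
    · rw [← sub_left_inj (a := l 3 ξ), h.jump, hlξ le_rfl, hk.continuedFamily_three_sub]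
  have hr {j : ℕ} (hj : j ≤ 3) : EqOn (r j) (continuedFamily c k f p q s ξ j) (Icc ξ 1) :=
    h.sobolev_right.eqOn_of_ode hξ.2
      (hk.isSobolevDerivs_continuedFamily hf (Ioo_subset_Icc_self hξ) p q s) h.ode_right
      (ae_of_all _ (hk.continuedFamily_four f p q s ξ)) hrξ hj
  have h1 : (1 : ℝ) ∈ Icc ξ 1 := right_mem_Icc.2 hξ.2.le
  refine ⟨p, q, fun x hx => ?_, (hr (by norm_num) h1).symm.trans h.right_zero,
    (hr (by norm_num) h1).symm.trans h.right_two⟩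
  rcases le_total x ξ with hxξ | hξx
  · rw [hk.forcedSolution_eqOn_left f p q s ξ hxξ, ← hl (by norm_num) ⟨hx.1, hxξ⟩,
      h.sobolev_left.zero x ⟨hx.1, hxξ⟩]
  · rw [forcedSolution_eqOn_right c k f p q s ξ hξx, ← hr (by norm_num) ⟨hξx, hx.2⟩,
      h.sobolev_right.zero x ⟨hξx, hx.2⟩]

end Shooting

section BoundarySystem

open Matrix

/-- The matrix of the linear system for `(p + λ² q, λ² q - p, u(ξ))` which expresses the boundary
conditions at `1` and the value at `ξ` of `forcedSolution (1 / a) (kernel a lam) f p q s ξ`, where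
`s = α (u₁(ξ) - μ u(ξ))`. -/
def boundaryMatrix (a α ξ : ℝ) (μ lam : ℂ) : Matrix (Fin 3) (Fin 3) ℂ :=
  !![Complex.sinh lam, 0, α * μ * Complex.sinh (lam * (ξ - 1));
    0, Complex.sin lam, -(α * μ * Complex.sin (lam * (ξ - 1)));
    Complex.sinh (lam * ξ), Complex.sin (lam * ξ), -(2 * a * lam ^ 3)]

/-- The right-hand side of the linear system with matrix `boundaryMatrix`. -/
def boundaryVector (a : ℝ) (lam A B C : ℂ) : Fin 3 → ℂ :=
  -(a * lam) • ![A + B, A - B, 2 * C]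

variable {a b α ξ : ℝ} {μ lam A B C p q X : ℂ} {u₁ v₁ : ℝ → ℂ}

theorem det_boundaryMatrix (ha : a ≠ 0) (α ξ : ℝ) (μ lam : ℂ) :
    4 * lam ^ 2 * (boundaryMatrix a α ξ μ lam).det = a * detAlpha a α ξ μ lam := by
  have ha' : (a : ℂ) ≠ 0 := Complex.ofReal_ne_zero.2 ha
  simp only [boundaryMatrix, det_fin_three, detAlpha, of_apply, cons_val]
  field_simp
  ring

theorem continuedFamily_kernel_two_add (a : ℝ) (hlam : lam ≠ 0) (f : ℝ → ℂ) (p q s : ℂ) (ξ : ℝ) :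
    continuedFamily (1 / a) (kernel a lam) f p q s ξ 2 1
        + lam ^ 2 * continuedFamily (1 / a) (kernel a lam) f p q s ξ 0 1
      = conv (kernel a lam 2) f 1 + lam ^ 2 * conv (kernel a lam 0) f 1
        + (p + lam ^ 2 * q) * (Complex.sinh lam / (a * lam))
        + s * (Complex.sinh (lam * ↑(1 - ξ)) / (a * lam)) := by
  have h1 := kernel_two_add_kernel_zero a hlam 1
  rw [Complex.ofReal_one, mul_one] at h1
  simp only [continuedFamily, Pi.add_apply, Pi.smul_apply, smul_eq_mul, initialValueFamily_apply,
    Nat.reduceLeDiff, zero_le, ← h1, ← kernel_two_add_kernel_zero a hlam]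
  linear_combination q * (isGreenFamily_kernel a hlam).periodic 0 1

theorem continuedFamily_kernel_two_sub (a : ℝ) (hlam : lam ≠ 0) (f : ℝ → ℂ) (p q s : ℂ) (ξ : ℝ) :
    continuedFamily (1 / a) (kernel a lam) f p q s ξ 2 1
        - lam ^ 2 * continuedFamily (1 / a) (kernel a lam) f p q s ξ 0 1
      = conv (kernel a lam 2) f 1 - lam ^ 2 * conv (kernel a lam 0) f 1
        + (p - lam ^ 2 * q) * (Complex.sin lam / (a * lam))
        + s * (Complex.sin (lam * ↑(1 - ξ)) / (a * lam)) := by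
  have h1 := kernel_two_sub_kernel_zero a hlam 1
  rw [Complex.ofReal_one, mul_one] at h1
  simp only [continuedFamily, Pi.add_apply, Pi.smul_apply, smul_eq_mul, initialValueFamily_apply,
    Nat.reduceLeDiff, zero_le, ← h1, ← kernel_two_sub_kernel_zero a hlam]
  linear_combination q * (isGreenFamily_kernel a hlam).periodic 0 1

theorem coeffA_eq (b α : ℝ) (lam μ : ℂ) (u₁ v₁ : ℝ → ℂ) (hξ : ξ ≤ 1) :
    coeffA a b α ξ μ lam u₁ v₁ = lam ^ 2 * (conv (kernel a lam 0) (f10 b μ u₁ v₁) 1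
      + α * u₁ ξ * kernel a lam 0 (1 - ξ)) := by
  rw [coeffA, conv_u0 a lam _ zero_le_one, u0_of_nonneg a lam (sub_nonneg.2 hξ)]
  ring

theorem coeffB_eq (hlam : lam ≠ 0) (hF : InEnergySpace u₁ v₁) (hξ : ξ ≤ 1) :
    coeffB a b α ξ μ lam u₁ v₁ = conv (kernel a lam 2) (f10 b μ u₁ v₁) 1
      + α * u₁ ξ * kernel a lam 2 (1 - ξ) := by
  rw [coeffB, iteratedDeriv_two_conv_u0 a hlam (memL2_f10 b μ hF).integrableOn one_pos,
    u0xx_of_nonneg a hlam (sub_nonneg.2 hξ)]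

theorem coeffA_add_coeffB (hlam : lam ≠ 0) (hF : InEnergySpace u₁ v₁) (hξ : ξ ≤ 1) :
    coeffA a b α ξ μ lam u₁ v₁ + coeffB a b α ξ μ lam u₁ v₁
      = conv (kernel a lam 2) (f10 b μ u₁ v₁) 1 + lam ^ 2 * conv (kernel a lam 0) (f10 b μ u₁ v₁) 1
        + α * u₁ ξ * (Complex.sinh (lam * ↑(1 - ξ)) / (a * lam)) := by
  rw [coeffA_eq b α lam μ u₁ v₁ hξ, coeffB_eq hlam hF hξ, ← kernel_two_add_kernel_zero a hlam]
  ring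

theorem coeffA_sub_coeffB (hlam : lam ≠ 0) (hF : InEnergySpace u₁ v₁) (hξ : ξ ≤ 1) :
    coeffA a b α ξ μ lam u₁ v₁ - coeffB a b α ξ μ lam u₁ v₁
      = lam ^ 2 * conv (kernel a lam 0) (f10 b μ u₁ v₁) 1 - conv (kernel a lam 2) (f10 b μ u₁ v₁) 1
        - α * u₁ ξ * (Complex.sin (lam * ↑(1 - ξ)) / (a * lam)) := by
  rw [coeffA_eq b α lam μ u₁ v₁ hξ, coeffB_eq hlam hF hξ, ← kernel_two_sub_kernel_zero a hlam]
  ring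

theorem sinh_add_coeffA_add_coeffB (ha : a ≠ 0) (hlam : lam ≠ 0) (hF : InEnergySpace u₁ v₁)
    (hξ : ξ ≤ 1) (p q X : ℂ) :
    Complex.sinh lam * (p + lam ^ 2 * q) + α * μ * Complex.sinh (lam * (ξ - 1)) * X
        + a * lam * (coeffA a b α ξ μ lam u₁ v₁ + coeffB a b α ξ μ lam u₁ v₁)
      = a * lam *
        (continuedFamily (1 / a) (kernel a lam) (f10 b μ u₁ v₁) p q (α * (u₁ ξ - μ * X)) ξ 2 1
          + lam ^ 2 * continuedFamily (1 / a) (kernel a lam) (f10 b μ u₁ v₁) p q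
            (α * (u₁ ξ - μ * X)) ξ 0 1) := by
  have ha' : (a : ℂ) ≠ 0 := Complex.ofReal_ne_zero.2 ha
  have hneg : lam * ↑(1 - ξ) = -(lam * (ξ - 1)) := by
    push_cast
    ring
  rw [continuedFamily_kernel_two_add a hlam, coeffA_add_coeffB hlam hF hξ, hneg, Complex.sinh_neg]
  field_simp
  ring

theorem sin_add_coeffA_sub_coeffB (ha : a ≠ 0) (hlam : lam ≠ 0) (hF : InEnergySpace u₁ v₁)
    (hξ : ξ ≤ 1) (p q X : ℂ) :
    Complex.sin lam * (lam ^ 2 * q - p) - α * μ * Complex.sin (lam * (ξ - 1)) * X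
        + a * lam * (coeffA a b α ξ μ lam u₁ v₁ - coeffB a b α ξ μ lam u₁ v₁)
      = -(a * lam) *
        (continuedFamily (1 / a) (kernel a lam) (f10 b μ u₁ v₁) p q (α * (u₁ ξ - μ * X)) ξ 2 1
          - lam ^ 2 * continuedFamily (1 / a) (kernel a lam) (f10 b μ u₁ v₁) p q
            (α * (u₁ ξ - μ * X)) ξ 0 1) := by
  have ha' : (a : ℂ) ≠ 0 := Complex.ofReal_ne_zero.2 ha
  have hneg : lam * ↑(1 - ξ) = -(lam * (ξ - 1)) := by
    push_cast
    ring
  rw [continuedFamily_kernel_two_sub a hlam, coeffA_sub_coeffB hlam hF hξ, hneg, Complex.sin_neg]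
  field_simp
  ring

theorem sinh_add_sin_add_coeffC (ha : a ≠ 0) (hlam : lam ≠ 0) (hξ : 0 ≤ ξ) (p q : ℂ) :
    Complex.sinh (lam * ξ) * (p + lam ^ 2 * q) + Complex.sin (lam * ξ) * (lam ^ 2 * q - p)
        + 2 * a * lam * coeffC a b ξ μ lam u₁ v₁
      = 2 * a * lam ^ 3 *
        initialValueFamily (1 / a) (kernel a lam) (f10 b μ u₁ v₁) p q 0 ξ := by
  have ha' : (a : ℂ) ≠ 0 := Complex.ofReal_ne_zero.2 ha
  rw [coeffC, conv_u0 a lam _ hξ, initialValueFamily_apply _ _ _ _ _ (Nat.zero_le 3)]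
  simp only [kernel]
  field_simp
  ring

theorem boundaryMatrix_mulVec_eq_boundaryVector_iff (y z X : ℂ) :
    boundaryMatrix a α ξ μ lam *ᵥ ![y, z, X] = boundaryVector a lam A B C ↔
      Complex.sinh lam * y + α * μ * Complex.sinh (lam * (ξ - 1)) * X + a * lam * (A + B) = 0 ∧
      Complex.sin lam * z - α * μ * Complex.sin (lam * (ξ - 1)) * X + a * lam * (A - B) = 0 ∧
      Complex.sinh (lam * ξ) * y + Complex.sin (lam * ξ) * z + 2 * a * lam * C
        = 2 * a * lam ^ 3 * X := by
  rw [boundaryMatrix, boundaryVector, cons_mulVec, cons_mulVec, cons_mulVec, empty_mulVec,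
    smul_cons, smul_cons, smul_cons, Matrix.smul_empty, vecCons_inj, vecCons_inj, vecCons_inj]
  simp only [vec3_dotProduct', smul_eq_mul, and_true]
  refine and_congr ?_ (and_congr ?_ ?_) <;> constructor <;> intro h <;> linear_combination h

theorem boundaryMatrix_mulVec_eq_iff (ha : a ≠ 0) (hlam : lam ≠ 0) (hξ : ξ ∈ Ioo (0 : ℝ) 1)
    (hF : InEnergySpace u₁ v₁) :
    boundaryMatrix a α ξ μ lam *ᵥ ![p + lam ^ 2 * q, lam ^ 2 * q - p, X]
        = boundaryVector a lam (coeffA a b α ξ μ lam u₁ v₁) (coeffB a b α ξ μ lam u₁ v₁)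
          (coeffC a b ξ μ lam u₁ v₁) ↔
      continuedFamily (1 / a) (kernel a lam) (f10 b μ u₁ v₁) p q (α * (u₁ ξ - μ * X)) ξ 0 1 = 0 ∧
      continuedFamily (1 / a) (kernel a lam) (f10 b μ u₁ v₁) p q (α * (u₁ ξ - μ * X)) ξ 2 1 = 0 ∧
      initialValueFamily (1 / a) (kernel a lam) (f10 b μ u₁ v₁) p q 0 ξ = X := by
  have ha' : (a : ℂ) ≠ 0 := Complex.ofReal_ne_zero.2 ha
  rw [boundaryMatrix_mulVec_eq_boundaryVector_iff, sinh_add_coeffA_add_coeffB ha hlam hF hξ.2.le,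
    sin_add_coeffA_sub_coeffB ha hlam hF hξ.2.le, sinh_add_sin_add_coeffC ha hlam hξ.1.le]
  generalize continuedFamily _ _ _ _ _ _ _ 0 1 = y₀
  generalize continuedFamily _ _ _ _ _ _ _ 2 1 = y₂
  simp only [mul_eq_zero, neg_eq_zero, mul_eq_mul_left_iff, ha', hlam, OfNat.ofNat_ne_zero,
    pow_eq_zero_iff, ne_eq, not_false_eq_true, false_or, or_false, ← and_assoc, and_congr_left_iff]
  refine fun _ => ⟨fun ⟨hadd, hsub⟩ => ?_, ?_⟩
  · have h2 : y₂ = 0 := by linear_combination (hadd + hsub) / 2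
    rw [h2, zero_add] at hadd
    simpa [hlam, h2] using hadd
  · rintro ⟨rfl, rfl⟩
    simp

theorem det_smul_eq_cramer {n R : Type*} [Fintype n] [DecidableEq n] [CommRing R]
    {M : Matrix n n R} {w b : n → R} (h : M *ᵥ w = b) : M.det • w = M.cramer b := by
  rw [cramer_eq_adjugate_mulVec, ← h, mulVec_mulVec, adjugate_mul, smul_mulVec, one_mulVec]

end BoundarySystem

section Resolvent

open Matrix

variable {a b α ξ : ℝ} {μ lam A B C p q X : ℂ} {u v u₁ v₁ : ℝ → ℂ}

theorem ne_zero_of_detAlpha_ne_zero (hdet : detAlpha a α ξ μ lam ≠ 0) : lam ≠ 0 := by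
  rintro rfl
  simp [detAlpha] at hdet

theorem solvesResolvent_forcedSolution (ha : a ≠ 0) (hlam₀ : lam ≠ 0) (hξ : ξ ∈ Ioo (0 : ℝ) 1)
    (hlam : lam ^ 4 = -(b * μ + μ ^ 2) / a) (hF : InEnergySpace u₁ v₁)
    (h : boundaryMatrix a α ξ μ lam *ᵥ ![p + lam ^ 2 * q, lam ^ 2 * q - p, X]
      = boundaryVector a lam (coeffA a b α ξ μ lam u₁ v₁) (coeffB a b α ξ μ lam u₁ v₁)
        (coeffC a b ξ μ lam u₁ v₁)) :
    SolvesResolvent a b α ξ μ u₁ v₁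
      (forcedSolution (1 / a) (kernel a lam) (f10 b μ u₁ v₁) p q (α * (u₁ ξ - μ * X)) ξ)
      (fun x => μ * forcedSolution (1 / a) (kernel a lam) (f10 b μ u₁ v₁) p q
        (α * (u₁ ξ - μ * X)) ξ x - u₁ x) := by
  have hk := isGreenFamily_kernel a hlam₀
  obtain ⟨h0, h2, hX⟩ := (boundaryMatrix_mulVec_eq_iff ha hlam₀ hξ hF).1 h
  rw [← hk.forcedSolution_eqOn_left _ p q (α * (u₁ ξ - μ * X)) ξ self_mem_Iic] at hX
  generalize hs : α * (u₁ ξ - μ * X) = s at *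
  have hsol := hk.isTransmissionSolution_forcedSolution (memL2_f10 b μ hF) hξ h0 h2
  generalize forcedSolution _ _ _ _ _ _ _ = u at hX hsol ⊢
  rw [← hs, ← hX, hlam] at hsol
  exact hsol.solvesResolvent ha hξ hF

theorem SolvesResolvent.exists_boundaryMatrix_mulVec_eq (ha : a ≠ 0) (hlam₀ : lam ≠ 0)
    (hξ : ξ ∈ Ioo (0 : ℝ) 1) (hlam : lam ^ 4 = -(b * μ + μ ^ 2) / a) (hF : InEnergySpace u₁ v₁)
    (h : SolvesResolvent a b α ξ μ u₁ v₁ u v) :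
    ∃ p q, boundaryMatrix a α ξ μ lam *ᵥ ![p + lam ^ 2 * q, lam ^ 2 * q - p, u ξ]
        = boundaryVector a lam (coeffA a b α ξ μ lam u₁ v₁) (coeffB a b α ξ μ lam u₁ v₁)
          (coeffC a b ξ μ lam u₁ v₁) ∧
      EqOn u (forcedSolution (1 / a) (kernel a lam) (f10 b μ u₁ v₁) p q
        (α * (u₁ ξ - μ * u ξ)) ξ) (Icc 0 1) := by
  have hk := isGreenFamily_kernel a hlam₀
  obtain ⟨l, r, hsol⟩ := h.exists_isTransmissionSolution ha hξ
  rw [← hlam] at hsol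
  obtain ⟨p, q, hu, h0, h2⟩ := hsol.exists_eqOn_forcedSolution hk
    (one_div_ne_zero (Complex.ofReal_ne_zero.2 ha)) (memL2_f10 b μ hF) hξ
  refine ⟨p, q, (boundaryMatrix_mulVec_eq_iff ha hlam₀ hξ hF).2 ⟨h0, h2, ?_⟩, hu⟩
  rw [hu (Ioo_subset_Icc_self hξ), hk.forcedSolution_eqOn_left _ p q _ ξ self_mem_Iic]

theorem exists_solvesResolvent (ha : a ≠ 0) (hξ : ξ ∈ Ioo (0 : ℝ) 1)
    (hlam : lam ^ 4 = -(b * μ + μ ^ 2) / a) (hdet : detAlpha a α ξ μ lam ≠ 0)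
    (hF : InEnergySpace u₁ v₁) : ∃ u v, SolvesResolvent a b α ξ μ u₁ v₁ u v := by
  have hlam₀ := ne_zero_of_detAlpha_ne_zero hdet
  have hunit : IsUnit (boundaryMatrix a α ξ μ lam) := by
    rw [isUnit_iff_isUnit_det, isUnit_iff_ne_zero]
    refine right_ne_zero_of_mul (a := 4 * lam ^ 2) ?_
    rw [det_boundaryMatrix ha]
    exact mul_ne_zero (Complex.ofReal_ne_zero.2 ha) hdet
  obtain ⟨w, hw⟩ := mulVec_surjective_iff_isUnit.2 hunit (boundaryVector a lam
    (coeffA a b α ξ μ lam u₁ v₁) (coeffB a b α ξ μ lam u₁ v₁) (coeffC a b ξ μ lam u₁ v₁))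
  have hpq : w = ![(w 0 - w 1) / 2 + lam ^ 2 * ((w 0 + w 1) / (2 * lam ^ 2)),
      lam ^ 2 * ((w 0 + w 1) / (2 * lam ^ 2)) - (w 0 - w 1) / 2, w 2] := by
    ext i
    fin_cases i <;> simp only [Fin.zero_eta, Fin.mk_one, Fin.reduceFinMk, cons_val] <;>
      field_simp <;> ring
  exact ⟨_, _, solvesResolvent_forcedSolution ha hlam₀ hξ hlam hF (hpq ▸ hw)⟩

theorem detAlpha_eq_detZero_add (a α ξ : ℝ) (μ lam : ℂ) :
    detAlpha a α ξ μ lam = detZero lam + α * Delta a ξ μ lam := by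
  simp only [detAlpha, detZero, Delta]
  ring

theorem detZero_mul_resolventZero (h : detZero lam ≠ 0) (x : ℝ) :
    detZero lam * resolventZero a b α ξ μ lam u₁ v₁ x
      = detZeroResolventZero a b α ξ μ lam u₁ v₁ x := by
  rw [resolventZero, detZeroResolventZero]
  field_simp

theorem cramer_boundaryMatrix_boundaryVector (a α ξ : ℝ) (μ lam A B C : ℂ) :
    (boundaryMatrix a α ξ μ lam).cramer (boundaryVector a lam A B C) = (a * lam) •
      ![2 * a * lam ^ 3 * (A + B) * Complex.sin lam
          - α * μ * (((A + B) * Complex.sin (lam * (ξ - 1))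
              + (A - B) * Complex.sinh (lam * (ξ - 1))) * Complex.sin (lam * ξ)
            - 2 * C * Complex.sinh (lam * (ξ - 1)) * Complex.sin lam),
        2 * a * lam ^ 3 * (A - B) * Complex.sinh lam
          + α * μ * (((A + B) * Complex.sin (lam * (ξ - 1))
              + (A - B) * Complex.sinh (lam * (ξ - 1))) * Complex.sinh (lam * ξ)
            - 2 * C * Complex.sin (lam * (ξ - 1)) * Complex.sinh lam),
        (A + B) * Complex.sin lam * Complex.sinh (lam * ξ)
          + (A - B) * Complex.sin (lam * ξ) * Complex.sinh lam
          - 2 * C * Complex.sin lam * Complex.sinh lam] := by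
  ext i
  rw [cramer_apply, det_fin_three]
  fin_cases i <;>
    simp only [boundaryMatrix, boundaryVector, updateCol_apply, of_apply, cons_val, Pi.smul_apply,
      smul_eq_mul, Fin.zero_eta, Fin.mk_one, Fin.reduceFinMk, Fin.reduceEq, reduceIte] <;>
    ring

theorem detAlpha_mul_of_boundaryMatrix_mulVec_eq (ha : a ≠ 0)
    (h : boundaryMatrix a α ξ μ lam *ᵥ ![p + lam ^ 2 * q, lam ^ 2 * q - p, X]
      = boundaryVector a lam A B C) :
    detAlpha a α ξ μ lam * p
        = a * (4 * lam ^ 6 * ((A + B) * Complex.sin lam - (A - B) * Complex.sinh lam)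
          + α * Delta1 a ξ μ lam A B C) ∧
      detAlpha a α ξ μ lam * q
        = a * (4 * lam ^ 4 * ((A - B) * Complex.sinh lam + (A + B) * Complex.sin lam)
          + α * Delta3 a ξ μ lam A B C) ∧
      detAlpha a α ξ μ lam * X = Delta0 ξ lam A B C := by
  have ha' : (a : ℂ) ≠ 0 := Complex.ofReal_ne_zero.2 ha
  have hD := det_boundaryMatrix ha α ξ μ lam
  have hcramer := det_smul_eq_cramer h
  rw [cramer_boundaryMatrix_boundaryVector] at hcramer
  have h0 := congr_fun hcramer 0
  have h1 := congr_fun hcramer 1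
  have h2 := congr_fun hcramer 2
  simp only [Pi.smul_apply, smul_eq_mul, cons_val] at h0 h1 h2
  refine ⟨mul_left_cancel₀ ha' ?_, mul_left_cancel₀ ha' ?_, mul_left_cancel₀ ha' ?_⟩
  · rw [Delta1]
    linear_combination (norm := (field_simp; ring)) 2 * lam ^ 2 * (h0 - h1) - p * hD
  · rw [Delta3]
    linear_combination (norm := (field_simp; ring)) 2 * (h0 + h1) - q * hD
  · rw [Delta0]
    linear_combination 4 * lam ^ 2 * h2 - X * hD

theorem detAlpha_mul_forcedSolution (hlam₀ : lam ≠ 0)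
    (hp : detAlpha a α ξ μ lam * p
      = a * (4 * lam ^ 6 * ((A + B) * Complex.sin lam - (A - B) * Complex.sinh lam)
        + α * Delta1 a ξ μ lam A B C))
    (hq : detAlpha a α ξ μ lam * q
      = a * (4 * lam ^ 4 * ((A - B) * Complex.sinh lam + (A + B) * Complex.sin lam)
        + α * Delta3 a ξ μ lam A B C))
    (hX : detAlpha a α ξ μ lam * X = Delta0 ξ lam A B C) (f : ℝ → ℂ) (y : ℂ) {x : ℝ} (hx : 0 ≤ x) :
    detAlpha a α ξ μ lam *
        forcedSolution (1 / a) (kernel a lam) f p q (α * (y - μ * X)) ξ x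
      = detZero lam * conv (u0 a lam) f x + a * bracketZero a lam A B x
        + α * (Delta a ξ μ lam * conv (u0 a lam) f x + a * Delta1 a ξ μ lam A B C * u0 a lam x
          + a * Delta3 a ξ μ lam A B C * u0xx a lam x
          + (y * detAlpha a α ξ μ lam - μ * Delta0 ξ lam A B C) * u0 a lam (x - ξ)) := by
  have hjump : kernel a lam 0 (x - ξ) * heaviside (x - ξ) = u0 a lam (x - ξ) := rfl
  rw [forcedSolution, hjump, initialValueFamily_apply _ _ _ _ _ (Nat.zero_le 3),
    ← conv_u0 a lam f hx, bracketZero, ← hX, u0_of_nonneg a lam hx, u0xx_of_nonneg a hlam₀ hx]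
  linear_combination conv (u0 a lam) f x * detAlpha_eq_detZero_add a α ξ μ lam
    + kernel a lam 0 x * hp + kernel a lam 2 x * hq

theorem SolvesResolvent.detAlpha_mul_fst (ha : a ≠ 0) (hξ : ξ ∈ Ioo (0 : ℝ) 1)
    (hlam : lam ^ 4 = -(b * μ + μ ^ 2) / a) (hlam₀ : lam ≠ 0) (hF : InEnergySpace u₁ v₁)
    (h : SolvesResolvent a b α ξ μ u₁ v₁ u v) {x : ℝ} (hx : x ∈ Icc (0 : ℝ) 1) :
    detAlpha a α ξ μ lam * u x = detZeroResolventZero a b α ξ μ lam u₁ v₁ x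
      + α * correction a b α ξ μ lam u₁ v₁ x := by
  obtain ⟨p, q, hM, hu⟩ := h.exists_boundaryMatrix_mulVec_eq ha hlam₀ hξ hlam hF
  obtain ⟨hp, hq, hX⟩ := detAlpha_mul_of_boundaryMatrix_mulVec_eq ha hM
  rw [hu hx]
  exact detAlpha_mul_forcedSolution hlam₀ hp hq hX (f10 b μ u₁ v₁) (u₁ ξ) hx.1

end Resolvent

end Beam

end

theorem mainTheorem6_general (a b α ξ : ℝ) (ha : a ≠ 0) (hξ : ξ ∈ Set.Ioo (0 : ℝ) 1) (μ lam : ℂ)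
    (hlam : lam ^ 4 = -((b : ℂ) * μ + μ ^ 2) / (a : ℂ))
    (hdet : Beam.detAlpha a α ξ μ lam ≠ 0)
    (u₁ v₁ : ℝ → ℂ) (hF : Beam.InEnergySpace u₁ v₁) :
    (∃ u v : ℝ → ℂ, Beam.SolvesResolvent a b α ξ μ u₁ v₁ u v) ∧
    ∀ u v : ℝ → ℂ, Beam.SolvesResolvent a b α ξ μ u₁ v₁ u v →
      ∀ x ∈ Set.Icc (0 : ℝ) 1,
        u x = 1 / Beam.detAlpha a α ξ μ lam *
            (Beam.detZeroResolventZero a b α ξ μ lam u₁ v₁ x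
              + α * Beam.correction a b α ξ μ lam u₁ v₁ x) ∧
        (Beam.detZero lam ≠ 0 →
          u x = 1 / Beam.detAlpha a α ξ μ lam *
            (Beam.detZero lam * Beam.resolventZero a b α ξ μ lam u₁ v₁ x
              + α * Beam.correction a b α ξ μ lam u₁ v₁ x)) ∧
        v x = μ * u x - u₁ x := by
  refine ⟨Beam.exists_solvesResolvent ha hξ hlam hdet hF, fun u v h x hx => ?_⟩
  have hlam₀ := Beam.ne_zero_of_detAlpha_ne_zero hdet
  have hu : u x = 1 / Beam.detAlpha a α ξ μ lam * (Beam.detZeroResolventZero a b α ξ μ lam u₁ v₁ x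
      + α * Beam.correction a b α ξ μ lam u₁ v₁ x) := by
    rw [← h.detAlpha_mul_fst ha hξ hlam hlam₀ hF hx, one_div, inv_mul_cancel_left₀ hdet]
  refine ⟨hu, fun hzero => ?_, h.snd_eq hx⟩
  rw [Beam.detZero_mul_resolventZero hzero, hu]

theorem mainTheorem6 (a b α ξ : ℝ) (ha : 0 < a) (hb : 0 < b) (hα : 0 < α)
    (hξ : ξ ∈ Set.Ioo (0 : ℝ) 1) (μ lam : ℂ)
    (hlam : lam ^ 4 = -((b : ℂ) * μ + μ ^ 2) / (a : ℂ))
    (hdet : Beam.detAlpha a α ξ μ lam ≠ 0)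
    (u₁ v₁ : ℝ → ℂ) (hF : Beam.InEnergySpace u₁ v₁) :
    (∃ u v : ℝ → ℂ, Beam.SolvesResolvent a b α ξ μ u₁ v₁ u v) ∧
    ∀ u v : ℝ → ℂ, Beam.SolvesResolvent a b α ξ μ u₁ v₁ u v →
      ∀ x ∈ Set.Icc (0 : ℝ) 1,
        u x = 1 / Beam.detAlpha a α ξ μ lam *
            (Beam.detZeroResolventZero a b α ξ μ lam u₁ v₁ x
              + α * Beam.correction a b α ξ μ lam u₁ v₁ x) ∧
        (Beam.detZero lam ≠ 0 →
          u x = 1 / Beam.detAlpha a α ξ μ lam *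
            (Beam.detZero lam * Beam.resolventZero a b α ξ μ lam u₁ v₁ x
              + α * Beam.correction a b α ξ μ lam u₁ v₁ x)) ∧
        v x = μ * u x - u₁ x :=
  mainTheorem6_general a b α ξ ha.ne' hξ μ lam hlam hdet u₁ v₁ hF
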